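/- Let $\omega=e^{i\pi/4}$ and let $X=\begin{bmatrix}0&1\\1&0\end{bmatrix}$, $H=\frac1{\sqrt2}\begin{bmatrix}1&1\\1&-1\end{bmatrix}$, $S=\begin{bmatrix}1&0\\0&i\end{bmatrix}$, $CX=I_2\oplus X$ and $CCX=I_6\oplus X$. A circuit on $N$ qubits over $\{X,CX,CCX,\omega H,S\}$ is a finite (possibly empty) product of these gates, each applied to distinct qubits among the $N$ and tensored with the identity on the remaining qubits. A complex $2^n\times 2^n$ matrix $V$ is exactly represented by a circuit with $m$ clean ancillas if there is a circuit $D$ on $n+m$ qubits such that $D|\psi\rangle|0\rangle^{\otimes m}=(V|\psi\rangle)|0\rangle^{\otimes m}$ for every $n$-qubit state $|\psi\rangle$; it is exactly representable if this holds for some $m\ge 0$. Let $\mathbb{Z}[1/2,i]=\{x_0+x_1i : x_0,x_1\in\mathbb{D}\}$, where $\mathbb{D}=\{u/2^q : u\in\mathbb{Z},\ q\in\mathbb{N}\}$, and let $U_{2^n}(\mathbb{Z}[1/2,i])$ be the group of unitary $2^n\times2^n$ matrices with all entries in $\mathbb{Z}[1/2,i]$. Let $n\ge 0$ and let $V$ be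 a complex $2^n\times 2^n$ matrix. Then $V$ is exactly representable over $\{X,CX,CCX,\omega H,S\}$ if and only if $V\in U_{2^n}(\mathbb{Z}[1/2,i])$. Moreover, every $V\in U_{2^n}(\mathbb{Z}[1/2,i])$ is exactly represented by a circuit over this gate set with a single clean ancilla. -/

import Mathlib

noncomputable section

/-- Labels of the computational basis of `n` qubits: bit strings of length `n`.  There are `2 ^ n`
of them, and qubit `0` is the leading (leftmost) one. -/
abbrev Bits (n : ℕ) : Type := Fin n → Fin 2

/-- `2 ^ n × 2 ^ n` complex matrices, written in the computational basis of `n` qubits. -/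
abbrev QMatrix (n : ℕ) : Type := Matrix (Bits n) (Bits n) ℂ

/-! ### Rings and unitary matrices -/

/-- The set of dyadic fractions `u / 2 ^ q`, with `u` an integer and `q` a natural number. -/
def dyadicFractions : Set ℝ := {x | ∃ (u : ℤ) (q : ℕ), x = (u : ℝ) / 2 ^ q}

theorem dyadicFractions_int (u : ℤ) : (u : ℝ) ∈ dyadicFractions := ⟨u, 0, by simp⟩

theorem dyadicFractions_add {x y : ℝ} (hx : x ∈ dyadicFractions) (hy : y ∈ dyadicFractions) :
    x + y ∈ dyadicFractions := by
  obtain ⟨u, q, rfl⟩ := hx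
  obtain ⟨v, r, rfl⟩ := hy
  refine ⟨u * 2 ^ r + v * 2 ^ q, q + r, ?_⟩
  push_cast
  field_simp
  ring

theorem dyadicFractions_neg {x : ℝ} (hx : x ∈ dyadicFractions) : -x ∈ dyadicFractions := by
  obtain ⟨u, q, rfl⟩ := hx
  exact ⟨-u, q, by push_cast; ring⟩

theorem dyadicFractions_mul {x y : ℝ} (hx : x ∈ dyadicFractions) (hy : y ∈ dyadicFractions) :
    x * y ∈ dyadicFractions := by
  obtain ⟨u, q, rfl⟩ := hx
  obtain ⟨v, r, rfl⟩ := hy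
  refine ⟨u * v, q + r, ?_⟩
  push_cast
  field_simp
  ring

/-- The ring `ℤ[1/2, i]` of all `x₀ + x₁ i` with `x₀, x₁` dyadic fractions. -/
def gaussianDyadic : Subring ℂ where
  carrier := {z | ∃ x₀ ∈ dyadicFractions, ∃ x₁ ∈ dyadicFractions,
    z = (x₀ : ℂ) + (x₁ : ℂ) * Complex.I}
  zero_mem' := ⟨0, by simpa using dyadicFractions_int 0, 0, by simpa using dyadicFractions_int 0,
    by simp⟩
  one_mem' := ⟨1, by simpa using dyadicFractions_int 1, 0, by simpa using dyadicFractions_int 0,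
    by simp⟩
  add_mem' := by
    rintro _ _ ⟨a, ha, b, hb, rfl⟩ ⟨c, hc, d, hd, rfl⟩
    exact ⟨a + c, dyadicFractions_add ha hc, b + d, dyadicFractions_add hb hd, by push_cast; ring⟩
  neg_mem' := by
    rintro _ ⟨a, ha, b, hb, rfl⟩
    exact ⟨-a, dyadicFractions_neg ha, -b, dyadicFractions_neg hb, by push_cast; ring⟩
  mul_mem' := by
    rintro _ _ ⟨a, ha, b, hb, rfl⟩ ⟨c, hc, d, hd, rfl⟩
    refine ⟨a * c + -(b * d),
      dyadicFractions_add (dyadicFractions_mul ha hc)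
        (dyadicFractions_neg (dyadicFractions_mul hb hd)),
      a * d + b * c,
      dyadicFractions_add (dyadicFractions_mul ha hd) (dyadicFractions_mul hb hc), ?_⟩
    push_cast
    linear_combination (b : ℂ) * d * Complex.I_mul_I

/-- `U_{2 ^ n}(R)`: the unitary `2 ^ n × 2 ^ n` matrices all of whose entries lie in `R ⊆ ℂ`. -/
def unitaryOver (n : ℕ) (R : Subring ℂ) : Set (QMatrix n) :=
  {V | V ∈ Matrix.unitaryGroup (Bits n) ℂ ∧ ∀ x y, V x y ∈ R}

/-! ### Gates -/

/-- A `2 × 2` matrix regarded as a matrix on one qubit. -/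
def oneQubit (M : Matrix (Fin 2) (Fin 2) ℂ) : QMatrix 1 := M.submatrix (fun x => x 0) (fun y => y 0)

/-- The controlled gate `I ⊕ G`; the control is the leading qubit. -/
def controlled {k : ℕ} (G : QMatrix k) : QMatrix (k + 1) := fun x y =>
  if x 0 = y 0 then
    if x 0 = 0 then (1 : QMatrix k) (Fin.tail x) (Fin.tail y) else G (Fin.tail x) (Fin.tail y)
  else 0

/-- `ω = e ^ (i π / 4)`. -/
def omega8 : ℂ := Complex.exp (Complex.I * (Real.pi : ℂ) / 4)

def gateX : QMatrix 1 := oneQubit !![0, 1; 1, 0]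

def gateH : QMatrix 1 := oneQubit ((1 / (Real.sqrt 2 : ℂ)) • !![1, 1; 1, -1])

def gateS : QMatrix 1 := oneQubit !![1, 0; 0, Complex.I]

/-- `CX = I₂ ⊕ X`. -/
def gateCX : QMatrix 2 := controlled gateX

/-- `CCX = I₄ ⊕ CX = I₆ ⊕ X`. -/
def gateCCX : QMatrix 3 := controlled gateCX

/-- A set of gates, each given with its number of qubits. -/
abbrev GateSet : Type := Set (Σ k : ℕ, QMatrix k)

/-- The gate set `{X, CX, CCX, ω H, S}`. -/
def gaussianGates : GateSet :=
  {⟨1, gateX⟩, ⟨2, gateCX⟩, ⟨3, gateCCX⟩, ⟨1, omega8 • gateH⟩, ⟨1, gateS⟩}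

/-! ### Circuits -/

/-- The gate `G` applied to the qubits `e 0, …, e (k - 1)` (in this order) out of `n` qubits, that
is, `G` on these qubits tensored with the identity on all the others. -/
def applyGate {k n : ℕ} (e : Fin k ↪ Fin n) (G : QMatrix k) : QMatrix n :=
  open Classical in
  fun x y => if ∀ j, j ∉ Set.range e → x j = y j then G (x ∘ e) (y ∘ e) else 0

/-- The matrices computed by the circuits on `n` qubits over the gate set `𝒢`: the finite products,
the empty one included, of gates from `𝒢` applied to pairwise distinct qubits. -/
def circuitMatrices (𝒢 : GateSet) (n : ℕ) : Submonoid (QMatrix n) :=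
  Submonoid.closure {M | ∃ (k : ℕ) (G : QMatrix k) (e : Fin k ↪ Fin n),
    (⟨k, G⟩ : Σ k : ℕ, QMatrix k) ∈ 𝒢 ∧ M = applyGate e G}

/-- The (pure) states of `n` qubits: the unit vectors. -/
def IsState {n : ℕ} (ψ : Bits n → ℂ) : Prop := ∑ x, ‖ψ x‖ ^ 2 = 1

/-- The product `|ψ⟩|φ⟩` of a vector on `n` qubits and a vector on `m` further qubits. -/
def tensorVec {n m : ℕ} (ψ : Bits n → ℂ) (φ : Bits m → ℂ) : Bits (n + m) → ℂ :=
  fun z => ψ (fun i => z (Fin.castAdd m i)) * φ (fun j => z (Fin.natAdd n j))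

/-- The state `|0⟩^{⊗ m}`. -/
def ketZero (m : ℕ) : Bits m → ℂ := Pi.single 0 1

/-- `V` is exactly represented by a circuit over `𝒢` with `m` clean ancillas: some circuit `D` on
`n + m` qubits satisfies `D |ψ⟩ |0⟩^{⊗ m} = (V |ψ⟩) |0⟩^{⊗ m}` for every `n`-qubit state `|ψ⟩`. -/
def RepresentableWithAncillas (𝒢 : GateSet) (m : ℕ) {n : ℕ} (V : QMatrix n) : Prop :=
  ∃ D ∈ circuitMatrices 𝒢 (n + m), ∀ ψ : Bits n → ℂ, IsState ψ →
    Matrix.mulVec D (tensorVec ψ (ketZero m)) = tensorVec (Matrix.mulVec V ψ) (ketZero m)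

/-- `V` is exactly represented by a circuit over `𝒢`, with any finite number of ancillas. -/
def Representable (𝒢 : GateSet) {n : ℕ} (V : QMatrix n) : Prop :=
  ∃ m : ℕ, RepresentableWithAncillas 𝒢 m V

end

/-! Necessity: the factor √2 in `ω` cancels the one in `H`, so every gate is unitary over ℤ[1/2, i],
and so is every circuit `D`. If `E` denotes the isometry that appends the ancillas, representability
says `D E = E V`. Then `V = Eᴴ D E` has entries in the ring, and `Vᴴ V = (D E)ᴴ (D E) = 1`
(`mem_unitaryOver_of_representableWithAncillas`).

Sufficiency is a column-by-column reduction of `V` to the identity by matrices that one clean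
ancilla can represent: phases `i` on one basis vector, and two-level copies of `X` and of `K = ωH`
(`phaseGate_mem`, `twoLevel_mem`). A column `v` has a least-denominator argument in the prime `1 +
i`: scale it so that `(1 + i) ^ k * v` is a vector of Gaussian integers, whose norms then sum to `2
^ k`. If `k > 0`, the number of coordinates prime to `1 + i` is even. Two of them agree mod 2 after
possibly multiplying one by `i`, and then `K` makes both divisible by `1 + i`. Once none is left,
`k` drops by one (`exists_even_reduction`, `exists_column_reduction`). At `k = 0` the column is a
power of `i` times a basis vector.

The two-level gates come from phases: `S` on a single basis vector, conjugated by an uncontrolled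
`K`, is a two-level square root of `X`, and this root together with `S` generates both `X` and `K`.
-/

open Matrix

noncomputable section

/-! ### Gates with a single target qubit -/

/-- The matrix acting on the qubit `t` by the `2 × 2` matrix `F x`, where `x` is the current bit
string; it is meaningful when `F x` does not depend on `x t`. -/
def targetGate {N : ℕ} (t : Fin N) (F : Bits N → Matrix (Fin 2) (Fin 2) ℂ) : QMatrix N :=
  fun x y => if ∀ j, j ≠ t → x j = y j then F x (x t) (y t) else 0

/-- The function `F` of bit strings does not depend on the bit `t`. -/
def IgnoresBit {N : ℕ} {α : Type*} (t : Fin N) (F : Bits N → α) : Prop :=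
  ∀ x b, F (Function.update x t b) = F x

theorem eq_update_of_agree {N : ℕ} {t : Fin N} {x y : Bits N} (h : ∀ j, j ≠ t → x j = y j) :
    y = Function.update x t (y t) := by
  ext j
  by_cases hj : j = t
  · subst hj; simp
  · simp [hj, h j hj]

theorem IgnoresBit.congr {N : ℕ} {α : Type*} {t : Fin N} {F : Bits N → α} (hF : IgnoresBit t F)
    {x y : Bits N} (h : ∀ j, j ≠ t → x j = y j) : F x = F y := by
  rw [eq_update_of_agree h, hF]

theorem targetGate_mul_apply {N : ℕ} (t : Fin N) (F : Bits N → Matrix (Fin 2) (Fin 2) ℂ)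
    {κ : Type*} (M : Matrix (Bits N) κ ℂ) (x : Bits N) (y : κ) :
    (targetGate t F * M) x y = ∑ b, F x (x t) b * M (Function.update x t b) y := by
  rw [Matrix.mul_apply]
  symm
  refine Finset.sum_of_injOn (fun b => Function.update x t b) ?_ (by simp) ?_ ?_
  · intro a _ b _ h
    simpa using congrFun h t
  · intro z _ hz
    rw [targetGate, if_neg, zero_mul]
    intro h
    exact hz ⟨z t, by simp, (eq_update_of_agree h).symm⟩
  · intro b _
    rw [targetGate, if_pos]
    · simp
    · intro j hj; simp [hj]

/-- The right factor is evaluated at a string whose bit `t` has already been altered, so it is `G`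
that must ignore this bit. -/
theorem targetGate_mul {N : ℕ} (t : Fin N) (F : Bits N → Matrix (Fin 2) (Fin 2) ℂ)
    {G : Bits N → Matrix (Fin 2) (Fin 2) ℂ} (hG : IgnoresBit t G) :
    targetGate t F * targetGate t G = targetGate t (fun x => F x * G x) := by
  ext x y
  have h (b : Fin 2) : (∀ j, j ≠ t → Function.update x t b j = y j) ↔ ∀ j, j ≠ t → x j = y j :=
    forall₂_congr fun j hj => by simp [hj]
  rw [targetGate_mul_apply]
  simp only [targetGate, h, hG x, Function.update_self]
  split_ifs <;> simp [Matrix.mul_apply]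

theorem targetGate_diagonal {N : ℕ} (t : Fin N) (d : Bits N → Fin 2 → ℂ) :
    targetGate t (fun x => Matrix.diagonal (d x)) = Matrix.diagonal (fun x => d x (x t)) := by
  ext x y
  rw [targetGate, Matrix.diagonal_apply, Matrix.diagonal_apply]
  by_cases hxy : x = y
  · subst hxy; simp
  · rw [if_neg hxy]
    split_ifs with h h' <;> try rfl
    refine absurd (funext fun j => ?_) hxy
    by_cases hj : j = t
    · exact hj ▸ h'
    · exact h j hj

theorem targetGate_one {N : ℕ} (t : Fin N) : targetGate t (fun _ => 1) = 1 := by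
  have h := targetGate_diagonal t (fun _ => (1 : Fin 2 → ℂ))
  have h1 : Matrix.diagonal (1 : Fin 2 → ℂ) = 1 := Matrix.diagonal_one
  rw [h1] at h
  rw [h]
  exact Matrix.diagonal_one

theorem targetGate_conjTranspose {N : ℕ} {t : Fin N} {F : Bits N → Matrix (Fin 2) (Fin 2) ℂ}
    (hF : IgnoresBit t F) : (targetGate t F)ᴴ = targetGate t (fun x => (F x)ᴴ) := by
  ext x y
  simp only [targetGate, Matrix.conjTranspose_apply]
  by_cases h : ∀ j, j ≠ t → x j = y j
  · rw [if_pos h, if_pos fun j hj => (h j hj).symm, hF.congr h]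
  · rw [if_neg h, if_neg fun h' => h fun j hj => (h' j hj).symm, star_zero]

theorem targetGate_mem_unitaryOver {N : ℕ} {t : Fin N} {F : Bits N → Matrix (Fin 2) (Fin 2) ℂ}
    (hF : IgnoresBit t F) (hu : ∀ x, F x ∈ Matrix.unitaryGroup (Fin 2) ℂ) {R : Subring ℂ}
    (hR : ∀ x a b, F x a b ∈ R) : targetGate t F ∈ unitaryOver N R := by
  refine ⟨?_, fun x y => ?_⟩
  · rw [Matrix.mem_unitaryGroup_iff', Matrix.star_eq_conjTranspose, targetGate_conjTranspose hF,
      targetGate_mul _ _ hF, ← targetGate_one t]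
    congr 1
    ext1 x
    exact Matrix.mem_unitaryGroup_iff'.1 (hu x)
  · rw [targetGate]
    split_ifs
    · exact hR x _ _
    · exact R.zero_mem

/-! ### The gates of the gate set -/

theorem applyGate_oneQubit {N : ℕ} (e : Fin 1 ↪ Fin N) (M : Matrix (Fin 2) (Fin 2) ℂ) :
    applyGate e (oneQubit M) = targetGate (e 0) (fun _ => M) := by
  ext x y
  have h : (∀ j, j ∉ Set.range e → x j = y j) ↔ ∀ j, j ≠ e 0 → x j = y j := by
    refine forall_congr' fun j => ?_
    simp [Fin.exists_fin_one, eq_comm]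
  simp only [applyGate, targetGate, oneQubit, h]
  rfl

/-- Peels off the leading control, so that `CX` and `CCX` reduce to `X`. The two conditions "equal
off the range" differ only at `e 0`, and both sides vanish when `x` and `y` differ there. -/
theorem applyGate_controlled {k N : ℕ} (e : Fin (k + 1) ↪ Fin N) (G : QMatrix k) :
    applyGate e (controlled G) = fun x y =>
      if x (e 0) = 1 then applyGate ((Fin.succEmb k).trans e) G x y else (1 : QMatrix N) x y := by
  ext x y
  have h0 : e 0 ∉ Set.range ((Fin.succEmb k).trans e) := by
    rintro ⟨i, hi⟩
    exact Fin.succ_ne_zero i (e.injective hi)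
  by_cases hxy : x (e 0) = y (e 0)
  · have h : (∀ j, j ∉ Set.range e → x j = y j) ↔
        ∀ j, j ∉ Set.range ((Fin.succEmb k).trans e) → x j = y j := by
      constructor
      · intro h j hj
        by_cases hje : j = e 0
        · rw [hje, hxy]
        · refine h j ?_
          rintro ⟨i, rfl⟩
          induction i using Fin.cases with
          | zero => exact hje rfl
          | succ i => exact hj ⟨i, rfl⟩
      · intro h j hj
        refine h j ?_
        rintro ⟨i, rfl⟩
        exact hj ⟨i.succ, rfl⟩
    rcases Fin.exists_fin_two.1 ⟨x (e 0), rfl⟩ with h1 | h1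
    · simp only [applyGate, controlled, Function.comp, hxy]
      rw [← hxy, h1]
      simp only [if_true, zero_ne_one, if_false, Matrix.one_apply]
      by_cases hx : x = y
      · subst hx; simp
      · rw [if_neg hx]
        split_ifs with h2 h3 <;> try rfl
        refine absurd (funext fun j => ?_) hx
        by_cases hj : j ∈ Set.range e
        · obtain ⟨i, rfl⟩ := hj
          induction i using Fin.cases with
          | zero => exact hxy
          | succ i => exact congrFun h3 i
        · exact h2 j hj
    · simp only [applyGate, controlled, Function.comp, h, hxy]
      rw [← hxy, h1]
      simp only [if_true, one_ne_zero, if_false]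
      rfl
  · have h1 : applyGate ((Fin.succEmb k).trans e) G x y = 0 := by
      rw [applyGate, if_neg fun h => hxy (h _ h0)]
    have h2 : (1 : QMatrix N) x y = 0 := Matrix.one_apply_ne fun h => hxy (by rw [h])
    rw [h1, h2, ite_self]
    simp only [applyGate, controlled, Function.comp, if_neg hxy, ite_self]

/-- The `2 × 2` matrix of the `X` gate. -/
def matX : Matrix (Fin 2) (Fin 2) ℂ := !![0, 1; 1, 0]

/-- The `2 × 2` matrix of the `S` gate. -/
def matS : Matrix (Fin 2) (Fin 2) ℂ := !![1, 0; 0, Complex.I]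

/-- The `2 × 2` matrix of the `ω H` gate. -/
def matK : Matrix (Fin 2) (Fin 2) ℂ := ((1 + Complex.I) / 2) • !![1, 1; 1, -1]

theorem omega8_div_sqrt_two : omega8 * (1 / (Real.sqrt 2 : ℂ)) = (1 + Complex.I) / 2 := by
  have h : omega8 = ((Real.sqrt 2 / 2 : ℝ) : ℂ) + ((Real.sqrt 2 / 2 : ℝ) : ℂ) * Complex.I := by
    rw [omega8, show Complex.I * (Real.pi : ℂ) / 4 = ((Real.pi / 4 : ℝ) : ℂ) * Complex.I by
      push_cast; ring, Complex.exp_mul_I, ← Complex.ofReal_cos, ← Complex.ofReal_sin,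
      Real.cos_pi_div_four, Real.sin_pi_div_four]
  have h2 : (Real.sqrt 2 : ℂ) ≠ 0 := by simp
  rw [h]
  push_cast
  field_simp

theorem omega8_smul_gateH : omega8 • gateH = oneQubit matK := by
  ext x y
  simp only [gateH, oneQubit, matK, ← omega8_div_sqrt_two, Matrix.smul_apply,
    Matrix.submatrix_apply, smul_eq_mul]
  ring

/-- The gate `X` on the qubit `t` controlled by the qubits in `A`. -/
def controlledX {N : ℕ} (A : Finset (Fin N)) (t : Fin N) : QMatrix N :=
  targetGate t (fun x => if ∀ a ∈ A, x a = 1 then matX else 1)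

theorem targetGate_ite {N : ℕ} {t a : Fin N} (F : Bits N → Matrix (Fin 2) (Fin 2) ℂ) :
    (fun x y => if x a = 1 then targetGate t F x y else (1 : QMatrix N) x y) =
      targetGate t (fun x => if x a = 1 then F x else 1) := by
  ext x y
  rw [← targetGate_one t]
  simp only [targetGate]
  split_ifs <;> rfl

theorem applyGate_gateX {N : ℕ} (e : Fin 1 ↪ Fin N) :
    applyGate e gateX = controlledX ∅ (e 0) := by
  simp [gateX, applyGate_oneQubit, controlledX, matX]

theorem applyGate_gateCX {N : ℕ} (e : Fin 2 ↪ Fin N) :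
    applyGate e gateCX = controlledX {e 0} (e 1) := by
  rw [gateCX, applyGate_controlled, applyGate_gateX, controlledX, targetGate_ite, controlledX]
  congr 1
  ext1 x
  simp

theorem applyGate_gateCCX {N : ℕ} (e : Fin 3 ↪ Fin N) :
    applyGate e gateCCX = controlledX {e 0, e 1} (e 2) := by
  rw [gateCCX, applyGate_controlled, applyGate_gateCX, controlledX, targetGate_ite, controlledX]
  congr 1
  ext1 x
  simp only [Finset.mem_insert, Finset.mem_singleton, forall_eq_or_imp, forall_eq, ← ite_and]
  rfl

theorem ignoresBit_const {N : ℕ} {α : Type*} (t : Fin N) (a : α) :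
    IgnoresBit t (fun _ => a) := fun _ _ => rfl

theorem ignoresBit_controls {N : ℕ} {α : Type*} {A : Finset (Fin N)} {t : Fin N} (h : t ∉ A)
    (M M' : α) : IgnoresBit t (fun x => if ∀ a ∈ A, x a = 1 then M else M') := by
  intro x b
  have : (∀ a ∈ A, Function.update x t b a = 1) ↔ ∀ a ∈ A, x a = 1 :=
    forall₂_congr fun a ha => by rw [Function.update_of_ne (ne_of_mem_of_not_mem ha h)]
  simp only [this]

theorem controlledX_mul_self {N : ℕ} {A : Finset (Fin N)} {t : Fin N} (h : t ∉ A) :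
    controlledX A t * controlledX A t = 1 := by
  rw [controlledX, targetGate_mul _ _ (ignoresBit_controls h _ _), ← targetGate_one t]
  congr 1
  ext1 x
  split_ifs
  · ext i j; fin_cases i <;> fin_cases j <;> simp [matX, Matrix.mul_apply]
  · simp

theorem controlledX_conjTranspose {N : ℕ} {A : Finset (Fin N)} {t : Fin N} (h : t ∉ A) :
    (controlledX A t)ᴴ = controlledX A t := by
  rw [controlledX, targetGate_conjTranspose (ignoresBit_controls h _ _)]
  congr 1
  ext1 x
  split_ifs
  · ext i j; fin_cases i <;> fin_cases j <;> simp [matX]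
  · simp

/-- A property of matrices holds for all gates from the gate set once it holds for the controlled
`X` gates, for `ω H` and for `S`. -/
theorem gaussianGates_cases {N : ℕ} {p : QMatrix N → Prop}
    (hX : ∀ (A : Finset (Fin N)) (t : Fin N), t ∉ A → p (controlledX A t))
    (hK : ∀ t, p (targetGate t fun _ => matK)) (hS : ∀ t, p (targetGate t fun _ => matS))
    {k : ℕ} {G : QMatrix k} (e : Fin k ↪ Fin N)
    (hG : (⟨k, G⟩ : Σ k : ℕ, QMatrix k) ∈ gaussianGates) : p (applyGate e G) := by
  rw [gaussianGates, omega8_smul_gateH] at hG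
  simp only [Set.mem_insert_iff, Set.mem_singleton_iff] at hG
  rcases hG with h | h | h | h | h <;> cases h
  · rw [applyGate_gateX]
    exact hX _ _ (by simp)
  · rw [applyGate_gateCX]
    exact hX _ _ (by simp)
  · rw [applyGate_gateCCX]
    exact hX _ _ (by simp)
  · rw [applyGate_oneQubit]
    exact hK _
  · rw [gateS, applyGate_oneQubit]
    exact hS _

/-! ### Circuits -/

theorem dyadicFractions_half : (1 / 2 : ℝ) ∈ dyadicFractions := ⟨1, 1, by norm_num⟩

theorem I_mem_gaussianDyadic : Complex.I ∈ gaussianDyadic :=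
  ⟨0, by simpa using dyadicFractions_int 0, 1, by simpa using dyadicFractions_int 1, by simp⟩

theorem half_mem_gaussianDyadic : (1 / 2 : ℂ) ∈ gaussianDyadic :=
  ⟨1 / 2, dyadicFractions_half, 0, by simpa using dyadicFractions_int 0, by simp⟩

theorem one_add_I_div_two_mem_gaussianDyadic : (1 + Complex.I) / 2 ∈ gaussianDyadic := by
  rw [div_eq_mul_one_div]
  exact gaussianDyadic.mul_mem (gaussianDyadic.add_mem gaussianDyadic.one_mem I_mem_gaussianDyadic)
    half_mem_gaussianDyadic

theorem matX_mem_unitaryGroup : matX ∈ Matrix.unitaryGroup (Fin 2) ℂ := by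
  rw [Matrix.mem_unitaryGroup_iff']
  ext i j
  fin_cases i <;> fin_cases j <;> simp [matX, Matrix.mul_apply, Matrix.star_apply]

theorem matS_mem_unitaryGroup : matS ∈ Matrix.unitaryGroup (Fin 2) ℂ := by
  rw [Matrix.mem_unitaryGroup_iff']
  ext i j
  fin_cases i <;> fin_cases j <;> simp [matS, Matrix.mul_apply, Matrix.star_apply]

theorem matK_mem_unitaryGroup : matK ∈ Matrix.unitaryGroup (Fin 2) ℂ := by
  rw [Matrix.mem_unitaryGroup_iff']
  have hI := Complex.I_mul_I
  ext i j
  fin_cases i <;> fin_cases j <;> simp [matK, Matrix.mul_apply, Matrix.star_apply, map_ofNat] <;>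
    linear_combination (-1 / 2) * hI

theorem matX_mem_gaussianDyadic (i j : Fin 2) : matX i j ∈ gaussianDyadic := by
  fin_cases i <;> fin_cases j <;> simp [matX, gaussianDyadic.zero_mem, gaussianDyadic.one_mem]

theorem matS_mem_gaussianDyadic (i j : Fin 2) : matS i j ∈ gaussianDyadic := by
  fin_cases i <;> fin_cases j <;>
    simp [matS, gaussianDyadic.zero_mem, gaussianDyadic.one_mem, I_mem_gaussianDyadic]

theorem matK_mem_gaussianDyadic (i j : Fin 2) : matK i j ∈ gaussianDyadic := by
  fin_cases i <;> fin_cases j <;>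
    simp [matK, one_add_I_div_two_mem_gaussianDyadic]

theorem unitaryOver_one_mem {n : ℕ} (R : Subring ℂ) : (1 : QMatrix n) ∈ unitaryOver n R := by
  refine ⟨one_mem _, fun x y => ?_⟩
  rw [Matrix.one_apply]
  split_ifs
  exacts [R.one_mem, R.zero_mem]

theorem unitaryOver_mul_mem {n : ℕ} {R : Subring ℂ} {V W : QMatrix n} (hV : V ∈ unitaryOver n R)
    (hW : W ∈ unitaryOver n R) : V * W ∈ unitaryOver n R :=
  ⟨mul_mem hV.1 hW.1, fun x y => R.sum_mem fun z _ => R.mul_mem (hV.2 x z) (hW.2 z y)⟩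

theorem circuitMatrices_subset_unitaryOver {N : ℕ} {D : QMatrix N}
    (hD : D ∈ circuitMatrices gaussianGates N) : D ∈ unitaryOver N gaussianDyadic := by
  induction hD using Submonoid.closure_induction with
  | one => exact unitaryOver_one_mem _
  | mul _ _ _ _ h1 h2 => exact unitaryOver_mul_mem h1 h2
  | mem D h =>
    obtain ⟨k, G, e, hG, rfl⟩ := h
    refine gaussianGates_cases (p := (· ∈ unitaryOver N gaussianDyadic)) (fun A t ht => ?_)
      (fun t => ?_) (fun t => ?_) e hG
    · refine targetGate_mem_unitaryOver (ignoresBit_controls ht _ _) (fun x => ?_) fun x a b => ?_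
      · split_ifs
        exacts [matX_mem_unitaryGroup, one_mem _]
      · split_ifs
        · exact matX_mem_gaussianDyadic a b
        · rw [Matrix.one_apply]
          split_ifs
          exacts [gaussianDyadic.one_mem, gaussianDyadic.zero_mem]
    · exact targetGate_mem_unitaryOver (ignoresBit_const _ _) (fun _ => matK_mem_unitaryGroup)
        fun _ => matK_mem_gaussianDyadic
    · exact targetGate_mem_unitaryOver (ignoresBit_const _ _) (fun _ => matS_mem_unitaryGroup)
        fun _ => matS_mem_gaussianDyadic

theorem targetGate_const_pow {N : ℕ} (t : Fin N) (M : Matrix (Fin 2) (Fin 2) ℂ) (k : ℕ) :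
    targetGate t (fun _ => M) ^ k = targetGate t (fun _ => M ^ k) := by
  induction k with
  | zero => simp [targetGate_one]
  | succ k ih => rw [pow_succ, ih, targetGate_mul _ _ (ignoresBit_const _ _)]; simp [pow_succ]

theorem matS_conjTranspose : matSᴴ = matS ^ 3 := by
  ext i j
  fin_cases i <;> fin_cases j <;> simp [matS, pow_succ, Matrix.mul_apply]

/-- Since `H ^ 2 = 1`, this is `ω ^ 2 = i`. Hence `K` has order 8 and its inverse is a positive
power, which keeps circuits closed under inversion. -/
theorem matK_sq : matK ^ 2 = Complex.I • 1 := by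
  have hI := Complex.I_mul_I
  ext i j
  fin_cases i <;> fin_cases j <;> simp [matK, pow_succ, Matrix.mul_apply]
  all_goals linear_combination (1 / 2) * hI

theorem matK_conjTranspose : matKᴴ = matK ^ 7 := by
  have hI := Complex.I_mul_I
  rw [show matK ^ 7 = (matK ^ 2) ^ 3 * matK by rw [← pow_mul, ← pow_succ], matK_sq, smul_pow,
    one_pow, smul_mul_assoc, one_mul]
  ext i j
  fin_cases i <;> fin_cases j <;> simp [matK]
  iterate 3 linear_combination (1 / 2) * hI
  linear_combination (-1 / 2) * hI

theorem applyGate_mem_circuitMatrices {𝒢 : GateSet} {k N : ℕ} (e : Fin k ↪ Fin N) {G : QMatrix k}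
    (hG : (⟨k, G⟩ : Σ k : ℕ, QMatrix k) ∈ 𝒢) : applyGate e G ∈ circuitMatrices 𝒢 N :=
  Submonoid.subset_closure ⟨k, G, e, hG, rfl⟩

theorem targetGate_matS_mem {N : ℕ} (t : Fin N) :
    targetGate t (fun _ => matS) ∈ circuitMatrices gaussianGates N := by
  have := applyGate_mem_circuitMatrices (𝒢 := gaussianGates) (G := gateS)
    (⟨fun _ => t, fun a b _ => Subsingleton.elim a b⟩ : Fin 1 ↪ Fin N) (by simp [gaussianGates])
  rwa [gateS, applyGate_oneQubit] at this

theorem targetGate_matK_mem {N : ℕ} (t : Fin N) :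
    targetGate t (fun _ => matK) ∈ circuitMatrices gaussianGates N := by
  have := applyGate_mem_circuitMatrices (𝒢 := gaussianGates) (G := omega8 • gateH)
    (⟨fun _ => t, fun a b _ => Subsingleton.elim a b⟩ : Fin 1 ↪ Fin N) (by simp [gaussianGates])
  rwa [omega8_smul_gateH, applyGate_oneQubit] at this

theorem controlledX_empty_mem {N : ℕ} (t : Fin N) :
    controlledX ∅ t ∈ circuitMatrices gaussianGates N := by
  have := applyGate_mem_circuitMatrices (𝒢 := gaussianGates) (G := gateX)
    (⟨fun _ => t, fun a b _ => Subsingleton.elim a b⟩ : Fin 1 ↪ Fin N) (by simp [gaussianGates])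
  rwa [applyGate_gateX] at this

theorem controlledX_pair_mem {N : ℕ} {a b t : Fin N} (hab : a ≠ b) (hat : a ≠ t) (hbt : b ≠ t) :
    controlledX {a, b} t ∈ circuitMatrices gaussianGates N := by
  have hinj : Function.Injective ![a, b, t] := by
    intro i j h
    fin_cases i <;> fin_cases j <;> simp_all [eq_comm]
  have := applyGate_mem_circuitMatrices (𝒢 := gaussianGates) (G := gateCCX)
    (⟨![a, b, t], hinj⟩ : Fin 3 ↪ Fin N) (by simp [gaussianGates])
  rwa [applyGate_gateCCX] at this

/-- Each gate has finite order, so its inverse is a power of itself: the `X` type gates are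
involutions, `S` has order 4 and `K` has order 8. -/
theorem conjTranspose_mem_circuitMatrices {N : ℕ} {D : QMatrix N}
    (hD : D ∈ circuitMatrices gaussianGates N) : Dᴴ ∈ circuitMatrices gaussianGates N := by
  induction hD using Submonoid.closure_induction with
  | one => simp [one_mem]
  | mul _ _ _ _ h1 h2 =>
    rw [Matrix.conjTranspose_mul]
    exact mul_mem h2 h1
  | mem D h =>
    obtain ⟨k, G, e, hG, rfl⟩ := h
    have hmem := applyGate_mem_circuitMatrices e hG
    revert hmem
    refine gaussianGates_cases (p := fun M => M ∈ circuitMatrices gaussianGates N →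
      Mᴴ ∈ circuitMatrices gaussianGates N) (fun A t ht h => ?_) (fun t h => ?_) (fun t h => ?_) e hG
    · rwa [controlledX_conjTranspose ht]
    · rw [targetGate_conjTranspose (ignoresBit_const _ _), matK_conjTranspose,
        ← targetGate_const_pow]
      exact pow_mem h 7
    · rw [targetGate_conjTranspose (ignoresBit_const _ _), matS_conjTranspose,
        ← targetGate_const_pow]
      exact pow_mem h 3

/-! ### Multiply controlled gates -/

/-- Controlled `X` gates permute the rows; adding 1 in `Fin 2` flips a bit. Products of such gates
can thus be compared as maps on bit strings. -/
theorem controlledX_mul_apply {N : ℕ} (A : Finset (Fin N)) (t : Fin N) {κ : Type*}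
    (M : Matrix (Bits N) κ ℂ) (x : Bits N) (y : κ) :
    (controlledX A t * M) x y =
      M (if ∀ a ∈ A, x a = 1 then Function.update x t (x t + 1) else x) y := by
  rw [controlledX, targetGate_mul_apply, Fin.sum_univ_two]
  have hx : ∀ b, x t = b → Function.update x t b = x := fun b hb => by rw [← hb]; simp
  split_ifs
  · rcases Fin.exists_fin_two.1 ⟨x t, rfl⟩ with h | h <;> simp [h, matX]
  · rcases Fin.exists_fin_two.1 ⟨x t, rfl⟩ with h | h <;> simp [h, hx _ h, Matrix.one_apply]

/-- A commutator with a borrowed qubit `c` in an arbitrary state. Writing `A` for the conjunction of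
its bits, the target receives `b c` and `b (c + A)`, which sum to `b A` mod 2, while `c` is flipped
twice and so restored. -/
theorem controlledX_insert {N : ℕ} {A : Finset (Fin N)} {b c t : Fin N} (ht : t ∉ A) (hc : c ∉ A)
    (hbt : b ≠ t) (hbc : b ≠ c) (hct : c ≠ t) :
    controlledX (insert b A) t =
      controlledX {b, c} t * (controlledX A c * (controlledX {b, c} t * (controlledX A c * 1))) := by
  have hA : ∀ (x : Bits N) (s : Fin N) (v : Fin 2), s ∉ A →
      ((∀ a ∈ A, Function.update x s v a = 1) ↔ ∀ a ∈ A, x a = 1) := fun x s v hs =>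
    forall₂_congr fun a ha => by rw [Function.update_of_ne (ne_of_mem_of_not_mem ha hs)]
  have hadd : ∀ v : Fin 2, v + 1 + 1 = v := by decide
  have hadd1 : ∀ v : Fin 2, v + 1 = 1 ↔ v ≠ 1 := by decide
  -- With a trailing identity on both sides, the claim becomes equality of two row indices.
  rw [← mul_one (controlledX (insert b A) t)]
  ext x y
  simp only [controlledX_mul_apply]
  refine congrArg (fun z => (1 : QMatrix N) z y) ?_
  obtain ⟨P, hP⟩ : ∃ P : Prop, (∀ a ∈ A, x a = 1) = P := ⟨_, rfl⟩
  classical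
  simp only [hP, Finset.mem_insert, Finset.mem_singleton, forall_eq_or_imp, forall_eq]
  by_cases h1 : P <;> by_cases h2 : x b = 1 <;> by_cases h3 : x c = 1 <;>
    simp only [h1, h2, h3, hA _ _ _ ht, hA _ _ _ hc, hP, Function.update_self,
      Function.update_of_ne hbt, Function.update_of_ne hbc, Function.update_of_ne hct,
      Function.update_of_ne hct.symm, hadd1, and_true, and_self, and_false, if_true, if_false,
      not_true, not_false_iff, ne_eq, hadd]
  all_goals
    ext j
    by_cases hjt : j = t
    · subst hjt
      simp [Function.update_of_ne hct.symm]
    · by_cases hjc : j = c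
      · subst hjc
        simp [hjt, h3]
      · simp [hjt, hjc]

/-- A controlled `X` gate is computed by a circuit as soon as some qubit is neither its target nor
one of its controls. -/
theorem controlledX_mem {N : ℕ} (A : Finset (Fin N)) :
    ∀ t : Fin N, t ∉ A → (∃ c, c ≠ t ∧ c ∉ A) →
      controlledX A t ∈ circuitMatrices gaussianGates N := by
  induction A using Finset.induction_on with
  | empty => exact fun t _ _ => controlledX_empty_mem t
  | insert b A hb ih =>
    rintro t ht ⟨c, hct, hc⟩
    simp only [Finset.mem_insert, not_or] at ht hc
    -- The new control `b` serves as the borrowed qubit for the smaller gate, whose target is `c`.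
    have hc' : controlledX A c ∈ circuitMatrices gaussianGates N :=
      ih c hc.2 ⟨b, Ne.symm hc.1, hb⟩
    have hb' : controlledX {b, c} t ∈ circuitMatrices gaussianGates N :=
      controlledX_pair_mem (Ne.symm hc.1) (Ne.symm ht.1) hct
    rw [controlledX_insert ht.2 hc.2 (Ne.symm ht.1) (Ne.symm hc.1) hct]
    exact mul_mem hb' (mul_mem hc' (mul_mem hb' (mul_mem hc' (one_mem _))))

/-- The controlled `S` gate. -/
def controlledS {N : ℕ} (a b : Fin N) : QMatrix N :=
  Matrix.diagonal fun x => if x a = 1 ∧ x b = 1 then Complex.I else 1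

/-- When both controls are on, `X S X Sᴴ = i Z` and `K X Kᴴ = Z`, so the product is the scalar `i`
on the borrowed qubit `c`; otherwise everything cancels. The scalar is a phase that depends on the
controls only. -/
theorem controlledS_eq {N : ℕ} {a b c : Fin N} (hac : a ≠ c) (hbc : b ≠ c) :
    controlledS a b =
      controlledX {a, b} c * targetGate c (fun _ => matS) * controlledX {a, b} c *
        targetGate c (fun _ => matSᴴ) * (targetGate c (fun _ => matK) * controlledX {a, b} c *
          targetGate c (fun _ => matKᴴ)) := by
  have h : c ∉ ({a, b} : Finset (Fin N)) := by simp [hac.symm, hbc.symm]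
  have h1 := targetGate_diagonal c (fun (x : Bits N) (_ : Fin 2) =>
    if x a = 1 ∧ x b = 1 then Complex.I else 1)
  have h2 : IgnoresBit c (fun x : Bits N => if ∀ j ∈ ({a, b} : Finset (Fin N)), x j = 1
      then matX else 1) := ignoresBit_controls h _ _
  have h3 : IgnoresBit c (fun x : Bits N => (if ∀ j ∈ ({a, b} : Finset (Fin N)), x j = 1
      then matX else 1) * matKᴴ) := fun x v =>
    congrArg (· * matKᴴ) (h2 x v)
  rw [controlledS, ← h1]
  simp only [controlledX, mul_assoc, targetGate_mul _ _ h2,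
    targetGate_mul _ _ (ignoresBit_const _ _)]
  rw [targetGate_mul _ _ fun x v => congrArg (matK * ·) (h3 x v)]
  have hI := Complex.I_mul_I
  congr 1
  ext1 x
  simp only [Finset.mem_insert, Finset.mem_singleton, forall_eq_or_imp, forall_eq]
  split_ifs
  · have hK : matKᴴ = ((1 - Complex.I) / 2) • !![1, 1; 1, -1] := by
      ext i j
      fin_cases i <;> fin_cases j <;> simp [matK] <;> ring
    have hS : matSᴴ = !![1, 0; 0, -Complex.I] := by
      ext i j
      fin_cases i <;> fin_cases j <;> simp [matS]
    have hZ : matK * (matX * matKᴴ) = !![1, 0; 0, -1] := by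
      rw [hK]
      ext i j
      fin_cases i <;> fin_cases j <;> simp [matK, matX, Matrix.mul_apply]
      · linear_combination (-1 / 2) * hI
      · linear_combination (1 / 2) * hI
    rw [hZ, hS]
    ext i j
    fin_cases i <;> fin_cases j <;> simp [matS, matX, Matrix.mul_apply]
  · have hK : matK * matKᴴ = 1 := Matrix.mem_unitaryGroup_iff.1 matK_mem_unitaryGroup
    have hS : matS * matSᴴ = 1 := Matrix.mem_unitaryGroup_iff.1 matS_mem_unitaryGroup
    rw [one_mul, one_mul, one_mul, hK, mul_one, hS]
    exact Matrix.diagonal_one.symm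

theorem controlledS_mem {N : ℕ} {a b : Fin N} (hab : a ≠ b) (h : ∃ c, c ≠ a ∧ c ≠ b) :
    controlledS a b ∈ circuitMatrices gaussianGates N := by
  obtain ⟨c, hca, hcb⟩ := h
  have hX := controlledX_pair_mem (N := N) hab hca.symm hcb.symm
  have hS := targetGate_matS_mem c
  have hK := targetGate_matK_mem c
  have hS' := conjTranspose_mem_circuitMatrices hS
  have hK' := conjTranspose_mem_circuitMatrices hK
  rw [targetGate_conjTranspose (ignoresBit_const _ _)] at hS' hK'
  rw [controlledS_eq hca.symm hcb.symm]
  exact mul_mem (mul_mem (mul_mem (mul_mem hX hS) hX) hS') (mul_mem (mul_mem hK hX) hK')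

/-! ### Clean ancillas -/

/-- The isometry `|ψ⟩ ↦ |ψ⟩|0⟩^{⊗ m}`. -/
def ancillaEmbedding (n m : ℕ) : Matrix (Bits (n + m)) (Bits n) ℂ :=
  fun z y => if z = Fin.append y 0 then 1 else 0

theorem eq_append_zero_iff {n m : ℕ} (z : Bits (n + m)) (y : Bits n) :
    z = Fin.append y 0 ↔ (fun i => z (Fin.castAdd m i)) = y ∧ (fun j => z (Fin.natAdd n j)) = 0 := by
  constructor
  · rintro rfl
    constructor <;> ext i <;> simp
  · rintro ⟨h1, h2⟩
    rw [← h1, ← h2]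
    exact (Fin.append_castAdd_natAdd).symm

theorem ancillaEmbedding_mulVec {n m : ℕ} (ψ : Bits n → ℂ) :
    ancillaEmbedding n m *ᵥ ψ = tensorVec ψ (ketZero m) := by
  ext z
  rw [Matrix.mulVec, dotProduct]
  simp only [ancillaEmbedding, eq_append_zero_iff, ite_and, ite_mul, one_mul, zero_mul,
    Finset.sum_ite_eq, Finset.mem_univ, if_true, tensorVec, ketZero, Pi.single_apply, mul_ite,
    mul_one, mul_zero]

theorem ancillaEmbedding_mul_apply {n m : ℕ} {κ : Type*} (V : Matrix (Bits n) κ ℂ)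
    (z : Bits (n + m)) (y : κ) : (ancillaEmbedding n m * V) z y =
      if (fun j => z (Fin.natAdd n j)) = 0 then V (fun i => z (Fin.castAdd m i)) y else 0 := by
  have h : (ancillaEmbedding n m * V) z y = _ :=
    congrFun (ancillaEmbedding_mulVec (m := m) fun x => V x y) z
  simpa only [tensorVec, ketZero, Pi.single_apply, mul_ite, mul_one, mul_zero] using h

theorem mul_ancillaEmbedding_apply {n m : ℕ} {κ : Type*} (D : Matrix κ (Bits (n + m)) ℂ)
    (x : κ) (y : Bits n) : (D * ancillaEmbedding n m) x y = D x (Fin.append y 0) := by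
  simp [Matrix.mul_apply, ancillaEmbedding]

theorem ancillaEmbedding_conjTranspose_mul_apply {n m : ℕ} {κ : Type*}
    (D : Matrix (Bits (n + m)) κ ℂ) (x : Bits n) (y : κ) :
    ((ancillaEmbedding n m)ᴴ * D) x y = D (Fin.append x 0) y := by
  simp only [Matrix.mul_apply, ancillaEmbedding, Matrix.conjTranspose_apply, apply_ite star,
    star_one, star_zero, ite_mul, one_mul, zero_mul, Finset.sum_ite_eq', Finset.mem_univ, if_true]

theorem ancillaEmbedding_isometry (n m : ℕ) :
    (ancillaEmbedding n m)ᴴ * ancillaEmbedding n m = 1 := by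
  ext x y
  rw [ancillaEmbedding_conjTranspose_mul_apply, ancillaEmbedding, Matrix.one_apply]
  refine if_congr ?_ rfl rfl
  rw [eq_append_zero_iff]
  simp only [Fin.append_left, Fin.append_right, Pi.zero_apply]
  exact and_iff_left rfl

/-- Basis vectors are states and they determine a matrix, so the condition on states is one matrix
identity. -/
theorem representableWithAncillas_iff {𝒢 : GateSet} {n m : ℕ} {V : QMatrix n} :
    RepresentableWithAncillas 𝒢 m V ↔ ∃ D ∈ circuitMatrices 𝒢 (n + m),
      D * ancillaEmbedding n m = ancillaEmbedding n m * V := by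
  refine exists_congr fun D => and_congr_right fun _ => ⟨fun h => ?_, fun h ψ _ => ?_⟩
  · refine Matrix.ext_of_mulVec_single fun y => ?_
    have hy : IsState (Pi.single y 1 : Bits n → ℂ) := by
      rw [IsState, Finset.sum_eq_single y]
      · simp
      · intro x _ hx; simp [hx]
      · simp
    rw [← Matrix.mulVec_mulVec, ← Matrix.mulVec_mulVec, ancillaEmbedding_mulVec,
      ancillaEmbedding_mulVec, h _ hy]
  · rw [← ancillaEmbedding_mulVec, ← ancillaEmbedding_mulVec, Matrix.mulVec_mulVec,
      Matrix.mulVec_mulVec, h]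

theorem mem_unitaryOver_of_representableWithAncillas {n m : ℕ} {V : QMatrix n}
    (h : RepresentableWithAncillas gaussianGates m V) : V ∈ unitaryOver n gaussianDyadic := by
  obtain ⟨D, hD, hV⟩ := representableWithAncillas_iff.1 h
  have hD' := circuitMatrices_subset_unitaryOver hD
  have hE := ancillaEmbedding_isometry n m
  have hDD : Dᴴ * D = 1 := Matrix.mem_unitaryGroup_iff'.1 hD'.1
  constructor
  · rw [Matrix.mem_unitaryGroup_iff', Matrix.star_eq_conjTranspose]
    calc Vᴴ * V = (ancillaEmbedding n m * V)ᴴ * (ancillaEmbedding n m * V) := by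
          rw [Matrix.conjTranspose_mul, Matrix.mul_assoc, ← Matrix.mul_assoc _ _ V, hE,
            Matrix.one_mul]
      _ = 1 := by
          rw [← hV, Matrix.conjTranspose_mul, Matrix.mul_assoc, ← Matrix.mul_assoc _ D, hDD,
            Matrix.one_mul, hE]
  · intro x y
    have : V = (ancillaEmbedding n m)ᴴ * (D * ancillaEmbedding n m) := by
      rw [hV, ← Matrix.mul_assoc, hE, Matrix.one_mul]
    rw [this, ancillaEmbedding_conjTranspose_mul_apply, mul_ancillaEmbedding_apply]
    exact hD'.2 _ _

/-- The matrices represented by a circuit with a single clean ancilla. -/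
def representableOne (n : ℕ) : Submonoid (QMatrix n) where
  carrier := {V | RepresentableWithAncillas gaussianGates 1 V}
  one_mem' := representableWithAncillas_iff.2 ⟨1, one_mem _, by rw [Matrix.one_mul, Matrix.mul_one]⟩
  -- The ancilla returns to its initial state, so the same one serves both circuits.
  mul_mem' := by
    intro V W hV hW
    obtain ⟨D, hD, hV⟩ := representableWithAncillas_iff.1 hV
    obtain ⟨D', hD', hW⟩ := representableWithAncillas_iff.1 hW
    refine representableWithAncillas_iff.2 ⟨D * D', mul_mem hD hD', ?_⟩
    rw [Matrix.mul_assoc, hW, ← Matrix.mul_assoc, hV, Matrix.mul_assoc]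

theorem mem_representableOne_iff {n : ℕ} {V : QMatrix n} : V ∈ representableOne n ↔
    ∃ D ∈ circuitMatrices gaussianGates (n + 1),
      D * ancillaEmbedding n 1 = ancillaEmbedding n 1 * V := representableWithAncillas_iff

/-- From `D E = E V` with `D` and `V` unitary follows `Dᴴ E = E Vᴴ`; unitarity of `V` is the
necessity direction. -/
theorem conjTranspose_mem_representableOne {n : ℕ} {V : QMatrix n} (hV : V ∈ representableOne n) :
    Vᴴ ∈ representableOne n := by
  have hu : V * Vᴴ = 1 :=
    Matrix.mem_unitaryGroup_iff.1 (mem_unitaryOver_of_representableWithAncillas hV).1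
  obtain ⟨D, hD, h⟩ := mem_representableOne_iff.1 hV
  have hDD : Dᴴ * D = 1 :=
    Matrix.mem_unitaryGroup_iff'.1 (circuitMatrices_subset_unitaryOver hD).1
  refine mem_representableOne_iff.2 ⟨Dᴴ, conjTranspose_mem_circuitMatrices hD, ?_⟩
  calc Dᴴ * ancillaEmbedding n 1 = Dᴴ * (ancillaEmbedding n 1 * V) * Vᴴ := by
        rw [Matrix.mul_assoc, Matrix.mul_assoc, hu, Matrix.mul_one]
    _ = ancillaEmbedding n 1 * Vᴴ := by rw [← h, ← Matrix.mul_assoc, hDD, Matrix.one_mul]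

theorem targetGate_const_mul_ancillaEmbedding {n m : ℕ} (t : Fin n)
    (M : Matrix (Fin 2) (Fin 2) ℂ) :
    targetGate (Fin.castAdd m t) (fun _ => M) * ancillaEmbedding n m =
      ancillaEmbedding n m * targetGate t (fun _ => M) := by
  ext z y
  rw [mul_ancillaEmbedding_apply, ancillaEmbedding_mul_apply]
  have h : (∀ j, j ≠ Fin.castAdd m t → z j = (Fin.append y 0 : Bits (n + m)) j) ↔
      (fun j => z (Fin.natAdd n j)) = 0 ∧ ∀ i, i ≠ t → z (Fin.castAdd m i) = y i := by
    constructor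
    · refine fun h => ⟨funext fun j => ?_, fun i hi => ?_⟩
      · have hj := h (Fin.natAdd n j) (by simp [Fin.ext_iff]; omega)
        simpa using hj
      · have hi' := h (Fin.castAdd m i) (by simpa using hi)
        simpa using hi'
    · rintro ⟨h1, h2⟩ j hj
      induction j using Fin.addCases with
      | left i => simpa using h2 i (by simpa using hj)
      | right j => simpa using congrFun h1 j
  simp only [targetGate, h, ite_and, Fin.append_left]

theorem targetGate_const_mem_representableOne {n : ℕ} {t : Fin n} {M : Matrix (Fin 2) (Fin 2) ℂ}
    (h : targetGate (Fin.castAdd 1 t) (fun _ => M) ∈ circuitMatrices gaussianGates (n + 1)) :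
    targetGate t (fun _ => M) ∈ representableOne n :=
  mem_representableOne_iff.2 ⟨_, h, targetGate_const_mul_ancillaEmbedding t M⟩

theorem diagonal_mul_ancillaEmbedding {n m : ℕ} {d : Bits (n + m) → ℂ} {d' : Bits n → ℂ}
    (h : ∀ y, d (Fin.append y 0) = d' y) :
    Matrix.diagonal d * ancillaEmbedding n m = ancillaEmbedding n m * Matrix.diagonal d' := by
  ext z y
  rw [Matrix.diagonal_mul, Matrix.mul_diagonal, ancillaEmbedding]
  split_ifs with hz
  · rw [hz, h, mul_one, one_mul]
  · rw [mul_zero, zero_mul]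

/-! ### Phase gates -/

/-- The diagonal matrix with entry `i` at `y` and `1` elsewhere. -/
def phaseGate {ι : Type*} [DecidableEq ι] (y : ι) : Matrix ι ι ℂ :=
  Matrix.diagonal fun x => if x = y then Complex.I else 1

theorem controlledX_conj_diagonal {N : ℕ} {A : Finset (Fin N)} {t : Fin N} (h : t ∉ A)
    (d : Bits N → ℂ) : controlledX A t * (Matrix.diagonal d * controlledX A t) =
      Matrix.diagonal fun x =>
        d (if ∀ a ∈ A, x a = 1 then Function.update x t (x t + 1) else x) := by
  ext x y
  have hx := congrFun (congrFun (controlledX_mul_self h) x) y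
  rw [controlledX_mul_apply] at hx
  rw [controlledX_mul_apply, Matrix.diagonal_mul, hx, Matrix.diagonal_apply, Matrix.one_apply,
    mul_ite, mul_one, mul_zero]

/-- With at least two qubits: compute a conjunction into the ancilla, apply a controlled `S`,
uncompute. -/
theorem phaseGate_ones_mem (n : ℕ) : phaseGate (fun _ => 1 : Bits n) ∈ representableOne n := by
  match n with
  | 0 =>
    -- On zero qubits the matrix is the scalar `i`, realised on the ancilla as `S X S X`.
    have hX := controlledX_empty_mem (0 : Fin 1)
    have hS := targetGate_matS_mem (0 : Fin 1)
    refine mem_representableOne_iff.2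
      ⟨_, mul_mem hS (mul_mem hX (mul_mem hS hX)), ?_⟩
    have hdiag : targetGate (0 : Fin 1) (fun _ => matS) =
        Matrix.diagonal fun x : Bits 1 => if x 0 = 0 then 1 else Complex.I := by
      rw [← targetGate_diagonal 0 fun _ b => if b = 0 then 1 else Complex.I]
      congr 1
      ext1 x
      ext i j
      fin_cases i <;> fin_cases j <;> simp [matS]
    rw [hdiag, controlledX_conj_diagonal (by simp), Matrix.diagonal_mul_diagonal]
    refine diagonal_mul_ancillaEmbedding fun y => ?_
    obtain rfl : y = fun _ => 1 := Subsingleton.elim _ _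
    have h0 : (Fin.append (fun _ => 1 : Bits 0) 0 : Bits (0 + 1)) 0 = 0 := Fin.append_right _ 0 0
    simp [h0]
  | 1 =>
    have h : phaseGate (fun _ => 1 : Bits 1) = targetGate 0 (fun _ => matS) := by
      rw [phaseGate, show (fun x : Bits 1 => if x = (fun _ => 1) then Complex.I else 1) =
        fun x => if x 0 = 1 then Complex.I else 1 by ext x; simp [funext_iff],
        ← targetGate_diagonal 0 fun _ b => if b = 1 then Complex.I else 1]
      congr 1
      ext1 x
      ext i j
      fin_cases i <;> fin_cases j <;> simp [matS]
    rw [h]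
    exact targetGate_const_mem_representableOne (targetGate_matS_mem _)
  | n + 2 =>
    -- The ancilla `a` collects the conjunction of all qubits but `b`. Leaving `b` out frees it as
    -- the borrowed qubit of that large gate; qubit `1` is the borrowed one for the controlled `S`
    -- on `b` and `a`.
    set b : Fin (n + 2 + 1) := Fin.castAdd 1 0 with hb
    set a : Fin (n + 2 + 1) := Fin.natAdd (n + 2) 0 with ha
    have hba : b ≠ a := by simp [hb, ha, Fin.ext_iff]
    set A : Finset (Fin (n + 2 + 1)) := {b, a}ᶜ with hA
    have hbA : b ∉ A := by simp [hA]
    have haA : a ∉ A := by simp [hA]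
    have hX := controlledX_mem A a haA ⟨b, hba, hbA⟩
    have hS := controlledS_mem hba ⟨Fin.castAdd 1 1, by simp [hb, Fin.ext_iff],
      by simp [ha, Fin.ext_iff]⟩
    refine mem_representableOne_iff.2 ⟨_, mul_mem hX (mul_mem hS hX), ?_⟩
    rw [controlledS, controlledX_conj_diagonal haA]
    refine diagonal_mul_ancillaEmbedding fun y => ?_
    have h0 : (Fin.append y 0 : Bits (n + 2 + 1)) a = 0 := Fin.append_right y 0 0
    have h1 : (Fin.append y 0 : Bits (n + 2 + 1)) b = y 0 := Fin.append_left y 0 0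
    have h2 : y = (fun _ => 1) ↔ y 0 = 1 ∧ ∀ j ∈ A, (Fin.append y 0 : Bits (n + 2 + 1)) j = 1 := by
      constructor
      · rintro rfl
        refine ⟨rfl, fun j hj => ?_⟩
        induction j using Fin.addCases with
        | left i => rw [Fin.append_left]
        | right i =>
          obtain rfl : i = 0 := Subsingleton.elim _ _
          exact absurd hj haA
      · rintro ⟨h3, h4⟩
        ext1 i
        by_cases hi : i = 0
        · rw [hi, h3]
        · have := h4 (Fin.castAdd 1 i) (by
            rw [hA, Finset.mem_compl, Finset.mem_insert, Finset.mem_singleton, not_or]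
            refine ⟨fun h => hi (Fin.castAdd_injective _ _ h), fun h => ?_⟩
            have hval := congrArg Fin.val h
            simp only [ha, Fin.val_castAdd, Fin.val_natAdd] at hval
            omega)
          rwa [Fin.append_left] at this
    by_cases h3 : ∀ j ∈ A, (Fin.append y 0 : Bits (n + 2 + 1)) j = 1
    · have h4 : y = (fun _ => 1) ↔ y 0 = 1 := h2.trans (and_iff_left h3)
      rw [if_pos h3]
      simp [h4, h0, h1, hba]
    · rw [if_neg h3, h0, h1, if_neg (by simp), if_neg fun h => h3 (h2.1 h).2]

/-- Any string is reached from `x` by changing one bit at a time. -/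
theorem bits_induction {n : ℕ} {p : Bits n → Prop} {x : Bits n} (hx : p x)
    (h : ∀ y t b, p y → p (Function.update y t b)) (z : Bits n) : p z := by
  have key : ∀ s : Finset (Fin n), p (s.piecewise z x) := by
    intro s
    induction s using Finset.induction_on with
    | empty => simpa using hx
    | insert j s _ ih =>
      rw [Finset.piecewise_insert]
      exact h _ _ _ ih
  simpa using key Finset.univ

/-- Conjugating by `X` on one qubit moves the marked string to its neighbour. -/
theorem phaseGate_mem {n : ℕ} (y : Bits n) : phaseGate y ∈ representableOne n := by
  refine bits_induction (p := (phaseGate · ∈ representableOne n)) (phaseGate_ones_mem n)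
     (fun y t b hy => ?_) y
  by_cases hb : b = y t
  · rwa [hb, Function.update_eq_self]
  · have hX : controlledX ∅ t ∈ representableOne n := by
      have h := controlledX_empty_mem (Fin.castAdd 1 t)
      simp only [controlledX, Finset.notMem_empty, false_imp_iff, implies_true, if_true] at h ⊢
      exact targetGate_const_mem_representableOne h
    have h := mul_mem hX (mul_mem hy hX)
    rw [phaseGate, controlledX_conj_diagonal (by simp)] at h
    convert h using 1
    rw [phaseGate]
    congr 1
    ext x
    have hb' : b = y t + 1 := by
      revert hb; generalize y t = c; revert b c; decide
    have hxy : ∀ c d : Fin 2, c = d + 1 ↔ c + 1 = d := by decide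
    have : x = Function.update y t b ↔ Function.update x t (x t + 1) = y := by
      constructor
      · rintro rfl
        rw [Function.update_self, Function.update_idem, hb', (hxy _ _).1 rfl,
          Function.update_eq_self]
      · rintro rfl
        rw [Function.update_idem, hb', Function.update_self, (hxy _ _).1 rfl,
          Function.update_eq_self]
    simp [this]

/-! ### Two-level matrices -/

/-- The matrix acting by `M` on the span of the basis vectors `a` and `b` (in this order), and as
the identity on the other basis vectors. -/
def twoLevel {ι : Type*} [DecidableEq ι] (a b : ι) (M : Matrix (Fin 2) (Fin 2) ℂ) :
    Matrix ι ι ℂ := fun x y =>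
  if x = a then (if y = a then M 0 0 else 0) + (if y = b then M 0 1 else 0)
  else if x = b then (if y = a then M 1 0 else 0) + (if y = b then M 1 1 else 0)
  else if x = y then 1 else 0

theorem twoLevel_mulVec {ι : Type*} [Fintype ι] [DecidableEq ι] (a b : ι) (M : Matrix (Fin 2) (Fin 2) ℂ)
    (v : ι → ℂ) :
    twoLevel a b M *ᵥ v = fun x =>
      if x = a then M 0 0 * v a + M 0 1 * v b
      else if x = b then M 1 0 * v a + M 1 1 * v b else v x := by
  ext x
  simp only [Matrix.mulVec, dotProduct, twoLevel]
  split_ifs <;> simp [add_mul, Finset.sum_add_distrib]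

theorem twoLevel_mul_apply {ι : Type*} [Fintype ι] [DecidableEq ι] (a b : ι) (M : Matrix (Fin 2) (Fin 2) ℂ)
    {κ : Type*} (N : Matrix ι κ ℂ) (x : ι) (y : κ) : (twoLevel a b M * N) x y =
      if x = a then M 0 0 * N a y + M 0 1 * N b y
      else if x = b then M 1 0 * N a y + M 1 1 * N b y else N x y :=
  congrFun (twoLevel_mulVec a b M fun z => N z y) x

theorem twoLevel_swap {ι : Type*} [DecidableEq ι] {a b : ι} (h : a ≠ b)
    (M : Matrix (Fin 2) (Fin 2) ℂ) :
    twoLevel b a M = twoLevel a b (matX * (M * matX)) := by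
  ext x y
  simp only [twoLevel, matX, Matrix.mul_apply, Fin.sum_univ_two, Matrix.of_apply, Matrix.cons_val',
    Matrix.cons_val_zero, Matrix.cons_val_one, Matrix.cons_val_fin_one]
  by_cases hxa : x = a
  · subst hxa; simp [h, add_comm]
  · by_cases hxb : x = b <;> simp [hxa, hxb, add_comm, h.symm]

/-- Used to walk along the hypercube: swapping `b` with a neighbour `c` carries a gate on `a, b` to
one on `a, c`. -/
theorem twoLevel_conj_swap {ι : Type*} [Fintype ι] [DecidableEq ι] {a b c : ι}
    (hab : a ≠ b) (hac : a ≠ c) (hbc : b ≠ c)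
    (M : Matrix (Fin 2) (Fin 2) ℂ) :
    twoLevel b c matX * (twoLevel a b M * twoLevel b c matX) = twoLevel a c M := by
  ext x y
  rw [twoLevel_mul_apply]
  simp only [twoLevel_mul_apply, if_neg hab.symm, if_neg hac.symm, if_neg hbc.symm]
  simp only [twoLevel, matX, Matrix.of_apply, Matrix.cons_val', Matrix.cons_val_zero,
    Matrix.cons_val_one, Matrix.cons_val_fin_one, zero_mul, one_mul, zero_add, add_zero, ite_self]
  by_cases hxa : x = a
  · subst hxa; by_cases hy : y = x <;> by_cases hy' : y = c <;> by_cases hy2 : y = b <;>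
      simp_all [eq_comm]
  · by_cases hxb : x = b
    · subst hxb; simp [hbc, hbc.symm, hxa, eq_comm (a := y)]
    · by_cases hxc : x = c <;>
        by_cases hy : y = a <;> by_cases hy' : y = c <;> by_cases hy2 : y = b <;>
        simp_all [eq_comm]

theorem twoLevel_matS {ι : Type*} [DecidableEq ι] {a b : ι} (hab : a ≠ b) : twoLevel a b matS = phaseGate b := by
  ext x y
  rw [phaseGate, Matrix.diagonal_apply]
  simp only [twoLevel, matS, Matrix.of_apply, Matrix.cons_val', Matrix.cons_val_zero,
    Matrix.cons_val_one, Matrix.cons_val_fin_one]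
  by_cases hxa : x = a
  · subst hxa; simp [hab, eq_comm]
  · by_cases hxb : x = b
    · subst hxb; simp [hab.symm, eq_comm]
    · simp [hxa, hxb]

/-- Two strings differing only in bit `t` form an edge, and a two-level matrix on an edge is a fully
controlled gate with target `t`. -/
theorem twoLevel_eq_targetGate {n : ℕ} (x : Bits n) (t : Fin n)
    (M : Matrix (Fin 2) (Fin 2) ℂ) :
    twoLevel (Function.update x t 0) (Function.update x t 1) M =
      targetGate t (fun w => if Function.update w t 0 = Function.update x t 0 then M else 1) := by
  have h01 : Function.update x t 0 ≠ Function.update x t 1 := fun h => by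
    simpa using congrFun h t
  have key : ∀ w : Bits n, Function.update w t 0 = Function.update x t 0 →
      ∃ b, w = Function.update x t b := by
    intro w hw
    refine ⟨w t, ?_⟩
    have := congrArg (fun u => Function.update u t (w t)) hw
    simpa using this
  rw [← Matrix.mul_one (targetGate t _)]
  ext w y
  rw [targetGate_mul_apply, Fin.sum_univ_two]
  by_cases hw : Function.update w t 0 = Function.update x t 0
  · obtain ⟨b, rfl⟩ := key w hw
    have hy : ∀ b, (1 : QMatrix n) (Function.update x t b) y =
        if y = Function.update x t b then 1 else 0 := fun b => by
      rw [Matrix.one_apply]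
      exact if_congr eq_comm rfl rfl
    rw [Function.update_idem, Function.update_idem, hy, hy]
    simp only [if_true, Function.update_self, twoLevel]
    rcases Fin.exists_fin_two.1 ⟨b, rfl⟩ with rfl | rfl
    · simp
    · simp [h01.symm]
  · have hw0 : ∀ b, w ≠ Function.update x t b := by
      rintro b rfl
      simp at hw
    rw [if_neg hw, twoLevel, if_neg (hw0 0), if_neg (hw0 1)]
    have hu : ∀ b, w t = b → Function.update w t b = w := by
      rintro b rfl
      simp
    rcases Fin.exists_fin_two.1 ⟨w t, rfl⟩ with h | h <;> simp [h, hu _ h, Matrix.one_apply]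

theorem matK_conj_matS : matK * (matS * matKᴴ) =
    (1 / 2 : ℂ) • !![1 + Complex.I, 1 - Complex.I; 1 - Complex.I, 1 + Complex.I] := by
  have hI := Complex.I_mul_I
  have hK : matKᴴ = ((1 - Complex.I) / 2) • !![1, 1; 1, -1] := by
    ext i j
    fin_cases i <;> fin_cases j <;> simp [matK] <;> ring
  rw [hK]
  ext i j
  fin_cases i <;> fin_cases j <;> simp [matK, matS, Matrix.mul_apply]
  · linear_combination (-(1 + Complex.I) / 4) * hI
  · linear_combination (-(1 - Complex.I) / 4) * hI
  · linear_combination (-(1 - Complex.I) / 4) * hI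
  · linear_combination (-(1 + Complex.I) / 4) * hI

/-- With `W = K S Kᴴ`, a square root of `X`, this reads `K = S W S`. Two-level versions of `S` and
`W` therefore suffice for `K`, and `matX_eq` does the same for `X`. -/
theorem matK_eq : matK = matS * ((matK * (matS * matKᴴ)) * matS) := by
  have hI := Complex.I_mul_I
  rw [matK_conj_matS]
  ext i j
  fin_cases i <;> fin_cases j <;> simp [matK, matS, Matrix.mul_apply]
  · ring
  · linear_combination (1 / 2) * hI
  · linear_combination (1 / 2) * hI
  · linear_combination (-(1 + Complex.I) / 2) * hI

theorem matX_eq : matX = (matK * (matS * matKᴴ)) * (matK * (matS * matKᴴ)) := by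
  have hI := Complex.I_mul_I
  rw [matK_conj_matS]
  ext i j
  fin_cases i <;> fin_cases j <;> simp [matX, Matrix.mul_apply]
  · linear_combination (-1 / 2) * hI
  · linear_combination (1 / 2) * hI
  · linear_combination (1 / 2) * hI
  · linear_combination (-1 / 2) * hI

theorem ignoresBit_agree {n : ℕ} {α : Type*} (x : Bits n) (t : Fin n) (M M' : α) :
    IgnoresBit t fun w : Bits n =>
      if Function.update w t 0 = Function.update x t 0 then M else M' := by
  intro w b
  simp

theorem twoLevel_edge_mul {n : ℕ} (x : Bits n) (t : Fin n) (M M' : Matrix (Fin 2) (Fin 2) ℂ) :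
    twoLevel (Function.update x t 0) (Function.update x t 1) (M * M') =
      twoLevel (Function.update x t 0) (Function.update x t 1) M *
        twoLevel (Function.update x t 0) (Function.update x t 1) M' := by
  simp only [twoLevel_eq_targetGate]
  rw [targetGate_mul _ _ (ignoresBit_agree x t _ _)]
  congr 1
  ext1 w
  split_ifs <;> simp

/-- The outer `K` needs no controls: off the edge it meets its inverse and cancels. -/
theorem twoLevel_edge_conj {n : ℕ} (x : Bits n) (t : Fin n) (M : Matrix (Fin 2) (Fin 2) ℂ) :
    twoLevel (Function.update x t 0) (Function.update x t 1) (matK * (M * matKᴴ)) =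
      targetGate t (fun _ => matK) *
        (twoLevel (Function.update x t 0) (Function.update x t 1) M *
          (targetGate t fun _ => matK)ᴴ) := by
  rw [targetGate_conjTranspose (ignoresBit_const _ _)]
  simp only [twoLevel_eq_targetGate]
  rw [targetGate_mul _ _ (ignoresBit_const _ _),
    targetGate_mul _ _ fun w b => congrArg (· * matKᴴ) (ignoresBit_agree x t _ _ w b)]
  congr 1
  ext1 w
  split_ifs
  · rfl
  · rw [Matrix.one_mul]
    exact (Matrix.mem_unitaryGroup_iff.1 matK_mem_unitaryGroup).symm

theorem twoLevel_edge_mem {n : ℕ} (x : Bits n) (t : Fin n) :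
    twoLevel (Function.update x t 0) (Function.update x t 1) matX ∈ representableOne n ∧
      twoLevel (Function.update x t 0) (Function.update x t 1) matK ∈ representableOne n := by
  have h01 : Function.update x t 0 ≠ Function.update x t 1 := fun h => by
    simpa using congrFun h t
  have hS : twoLevel (Function.update x t 0) (Function.update x t 1) matS ∈ representableOne n := by
    rw [twoLevel_matS h01]
    exact phaseGate_mem _
  have hK : targetGate t (fun _ => matK) ∈ representableOne n :=
    targetGate_const_mem_representableOne (targetGate_matK_mem _)
  have hV : twoLevel (Function.update x t 0) (Function.update x t 1) (matK * (matS * matKᴴ)) ∈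
      representableOne n := by
    rw [twoLevel_edge_conj]
    exact mul_mem hK (mul_mem hS (conjTranspose_mem_representableOne hK))
  constructor
  · rw [matX_eq, twoLevel_edge_mul]
    exact mul_mem hV hV
  · rw [matK_eq, twoLevel_edge_mul, twoLevel_edge_mul]
    exact mul_mem hS (mul_mem hV hS)

theorem twoLevel_update_mem {n : ℕ} (x : Bits n) (t : Fin n) {b : Fin 2} (hb : b ≠ x t) :
    twoLevel x (Function.update x t b) matX ∈ representableOne n ∧
      twoLevel x (Function.update x t b) matK ∈ representableOne n := by
  have h01 : Function.update x t 0 ≠ Function.update x t 1 := fun h => by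
    simpa using congrFun h t
  obtain ⟨hX, hK⟩ := twoLevel_edge_mem x t
  rcases Fin.exists_fin_two.1 ⟨x t, rfl⟩ with h | h
  · have hb1 : b = 1 := by rw [h] at hb; exact Fin.eq_one_of_ne_zero b hb
    have hx : Function.update x t 0 = x := by rw [← h]; simp
    rw [hx] at hX hK
    rw [hb1]
    exact ⟨hX, hK⟩
  · have hb0 : b = 0 := by rw [h] at hb; revert b; decide
    have hx : Function.update x t 1 = x := by rw [← h]; simp
    have : twoLevel x (Function.update x t b) =
        twoLevel (Function.update x t 1) (Function.update x t 0) := by rw [hx, hb0]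
    rw [this, twoLevel_swap h01, twoLevel_swap h01]
    simp only [twoLevel_edge_mul]
    exact ⟨mul_mem hX (mul_mem hX hX), mul_mem hX (mul_mem hK hX)⟩

/-- Induction along a path of bit changes from `x` to `y`, conjugating by the swap on each edge;
when the path is at `x` itself, the edge gate is already the one wanted. -/
theorem twoLevel_mem {n : ℕ} {x y : Bits n} (hxy : x ≠ y) :
    twoLevel x y matX ∈ representableOne n ∧ twoLevel x y matK ∈ representableOne n := by
  revert hxy
  refine bits_induction (p := fun y => x ≠ y → twoLevel x y matX ∈ representableOne n ∧
    twoLevel x y matK ∈ representableOne n) (fun h => absurd rfl h) (fun y t b ih hx => ?_) y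
  by_cases hb : b = y t
  · rw [hb, Function.update_eq_self] at hx ⊢
    exact ih hx
  · have hedge := twoLevel_update_mem y t hb
    by_cases hxy : x = y
    · rwa [hxy]
    · have hne : y ≠ Function.update y t b := fun h => hb (by simpa using (congrFun h t).symm)
      rw [← twoLevel_conj_swap hxy hx hne, ← twoLevel_conj_swap hxy hx hne]
      exact ⟨mul_mem hedge.1 (mul_mem (ih hxy).1 hedge.1),
        mul_mem hedge.1 (mul_mem (ih hxy).2 hedge.1)⟩

/-! ### Gaussian integers -/

/-- The complex number `z` is a Gaussian integer. -/
def IsGaussianInteger (z : ℂ) : Prop := ∃ p q : ℤ, z = p + q * Complex.I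

theorem IsGaussianInteger.mul {z w : ℂ} (hz : IsGaussianInteger z) (hw : IsGaussianInteger w) :
    IsGaussianInteger (z * w) := by
  obtain ⟨p, q, rfl⟩ := hz
  obtain ⟨r, s, rfl⟩ := hw
  refine ⟨p * r - q * s, p * s + q * r, ?_⟩
  push_cast
  linear_combination (q : ℂ) * s * Complex.I_mul_I

theorem IsGaussianInteger.pow {z : ℂ} (hz : IsGaussianInteger z) (k : ℕ) :
    IsGaussianInteger (z ^ k) := by
  induction k with
  | zero => exact ⟨1, 0, by simp⟩
  | succ k ih => rw [pow_succ]; exact ih.mul hz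

/-- Since `(1 + i) ^ 2 = 2 i`, even powers of `1 + i` clear powers of 2 up to a unit. -/
theorem exists_pow_mul_isGaussianInteger {z : ℂ} (hz : z ∈ gaussianDyadic) :
    ∃ k, IsGaussianInteger ((1 + Complex.I) ^ k * z) := by
  obtain ⟨_, ⟨u, a, rfl⟩, _, ⟨w, b, rfl⟩, rfl⟩ := hz
  have h2 : (1 + Complex.I) ^ 2 = Complex.I * 2 := by linear_combination Complex.I_mul_I
  have h0 : (2 : ℂ) ≠ 0 := two_ne_zero
  have hI : IsGaussianInteger Complex.I := ⟨0, 1, by simp⟩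
  refine ⟨2 * (a + b), ?_⟩
  have : (1 + Complex.I) ^ (2 * (a + b)) * ((((u : ℝ) / 2 ^ a : ℝ) : ℂ) +
      (((w : ℝ) / 2 ^ b : ℝ) : ℂ) * Complex.I) =
      Complex.I ^ (a + b) * (((u * 2 ^ b : ℤ) : ℂ) + ((w * 2 ^ a : ℤ) : ℂ) * Complex.I) := by
    rw [pow_mul, h2, mul_pow]
    push_cast
    field_simp
    ring
  rw [this]
  exact (hI.pow _).mul ⟨_, _, rfl⟩

theorem exists_common_pow_mul_isGaussianInteger {ι : Type*} [Fintype ι] {v : ι → ℂ}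
    (hv : ∀ x, v x ∈ gaussianDyadic) :
    ∃ k, ∀ x, IsGaussianInteger ((1 + Complex.I) ^ k * v x) := by
  choose k hk using fun x => exists_pow_mul_isGaussianInteger (hv x)
  have h1 : IsGaussianInteger (1 + Complex.I) := ⟨1, 1, by simp⟩
  refine ⟨Finset.univ.sup k, fun x => ?_⟩
  rw [← Nat.sub_add_cancel (Finset.le_sup (f := k) (Finset.mem_univ x)), pow_add, mul_assoc]
  exact (h1.pow _).mul (hk x)

/-! ### Column reduction -/

theorem sum_normSq_mulVec {ι : Type*} [Fintype ι] [DecidableEq ι] {g : Matrix ι ι ℂ}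
    (hg : g ∈ Matrix.unitaryGroup ι ℂ) (v : ι → ℂ) :
    ∑ x, Complex.normSq ((g *ᵥ v) x) = ∑ x, Complex.normSq (v x) := by
  have h : ∀ w : ι → ℂ, ((∑ x, Complex.normSq (w x) : ℝ) : ℂ) = star w ⬝ᵥ w := fun w => by
    simp [dotProduct, Complex.normSq_eq_conj_mul_self]
  have h1 : gᴴ * g = 1 := Matrix.mem_unitaryGroup_iff'.1 hg
  apply Complex.ofReal_injective
  rw [h, h, Matrix.star_mulVec, ← Matrix.dotProduct_mulVec, Matrix.mulVec_mulVec, h1,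
    Matrix.one_mulVec]

/-- If a unitary matrix fixes a basis vector, it preserves the corresponding coordinate. -/
theorem mulVec_apply_of_fixes {ι : Type*} [Fintype ι] [DecidableEq ι] {g : Matrix ι ι ℂ}
    (hg : g ∈ Matrix.unitaryGroup ι ℂ) {x : ι} (hx : g *ᵥ Pi.single x 1 = Pi.single x 1)
    (v : ι → ℂ) : (g *ᵥ v) x = v x := by
  have h1 : gᴴ * g = 1 := Matrix.mem_unitaryGroup_iff'.1 hg
  have h2 : gᴴ *ᵥ Pi.single x 1 = Pi.single x 1 := by
    conv_lhs => rw [← hx]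
    rw [Matrix.mulVec_mulVec, h1, Matrix.one_mulVec]
  have h3 := congrArg star h2
  rw [Matrix.star_mulVec, Matrix.conjTranspose_conjTranspose, ← Pi.single_star, star_one] at h3
  calc (g *ᵥ v) x = Pi.single x 1 ⬝ᵥ g *ᵥ v := (single_one_dotProduct x _).symm
    _ = v x := by rw [Matrix.dotProduct_mulVec, h3, single_one_dotProduct]

/-- The matrices that are represented with one clean ancilla and fix all basis vectors outside
`T`. -/
def representableFixing {n : ℕ} (T : Finset (Bits n)) : Submonoid (QMatrix n) where
  carrier := {g | g ∈ representableOne n ∧ ∀ x, x ∉ T → g *ᵥ Pi.single x 1 = Pi.single x 1}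
  one_mem' := ⟨one_mem _, fun x _ => Matrix.one_mulVec _⟩
  mul_mem' := by
    rintro g g' ⟨hg, hg'⟩ ⟨h, h'⟩
    refine ⟨mul_mem hg h, fun x hx => ?_⟩
    rw [← Matrix.mulVec_mulVec, h' x hx, hg' x hx]

theorem phaseGate_mulVec_apply {ι : Type*} [Fintype ι] [DecidableEq ι] (y : ι) (v : ι → ℂ)
    (x : ι) : (phaseGate y *ᵥ v) x = if x = y then Complex.I * v x else v x := by
  rw [phaseGate, Matrix.mulVec_diagonal, ite_mul, one_mul]

theorem phaseGate_mem_representableFixing {n : ℕ} {T : Finset (Bits n)} {y : Bits n} (hy : y ∈ T) :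
    phaseGate y ∈ representableFixing T := by
  refine ⟨phaseGate_mem y, fun x hx => ?_⟩
  ext z
  rw [phaseGate_mulVec_apply]
  by_cases hz : z = y
  · subst hz
    simp [ne_of_mem_of_not_mem hy hx]
  · simp [hz]

theorem twoLevel_fixes {n : ℕ} {T : Finset (Bits n)} {a b x : Bits n} (ha : a ∈ T) (hb : b ∈ T)
    (hx : x ∉ T) (M : Matrix (Fin 2) (Fin 2) ℂ) :
    twoLevel a b M *ᵥ Pi.single x 1 = Pi.single x 1 := by
  ext z
  rw [twoLevel_mulVec]
  simp only [Pi.single_apply, ne_of_mem_of_not_mem ha hx, ne_of_mem_of_not_mem hb hx, if_false,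
    mul_zero, add_zero]
  split_ifs with h1 h2 h3 h4 h5 <;> try rfl
  · exact absurd (h1.symm.trans h2) (ne_of_mem_of_not_mem ha hx)
  · exact absurd (h3.symm.trans h4) (ne_of_mem_of_not_mem hb hx)

/-- Two odd coordinates can be made even. -/
theorem exists_pair_reduction {n : ℕ} {T : Finset (Bits n)} {c : ℂ} {v : Bits n → ℂ}
    {p q : Bits n → ℤ} (hv : ∀ x, c * v x = p x + q x * Complex.I) {a b : Bits n} (ha : a ∈ T)
    (hb : b ∈ T) (hab : a ≠ b) (hoa : Odd (p a + q a)) (hob : Odd (p b + q b)) :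
    ∃ g ∈ representableFixing T, ∃ p' q' : Bits n → ℤ,
      (∀ x, c * (g *ᵥ v) x = p' x + q' x * Complex.I) ∧
      Even (p' a + q' a) ∧ Even (p' b + q' b) ∧
      ∀ x, x ≠ a → x ≠ b → p' x = p x ∧ q' x = q x := by
  have hI := Complex.I_mul_I
  have hK : twoLevel a b matK ∈ representableFixing T :=
    ⟨(twoLevel_mem hab).2, fun x hx => twoLevel_fixes ha hb hx _⟩
  -- If the two scaled coordinates agree mod 2, their half sum and half difference are Gaussian
  -- integers, and `K` returns these times `1 + i`. The witnesses below are the parts of `(1 + i)(r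
  -- + s i)` and `(1 + i)((r - P) + (s - Q) i)`. An even sum of parts means divisibility by `1 + i`.
  have key : ∀ (w : Bits n → ℂ) (P Q : ℤ), c * w a = p a + q a * Complex.I →
      c * w b = P + Q * Complex.I → (∀ x, x ≠ a → x ≠ b → c * w x = p x + q x * Complex.I) →
      Even (p a + P) → Even (q a + Q) → ∃ p' q' : Bits n → ℤ,
        (∀ x, c * (twoLevel a b matK *ᵥ w) x = p' x + q' x * Complex.I) ∧
        Even (p' a + q' a) ∧ Even (p' b + q' b) ∧
        ∀ x, x ≠ a → x ≠ b → p' x = p x ∧ q' x = q x := by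
    rintro w P Q hwa hwb hw ⟨r, hr⟩ ⟨s, hs⟩
    refine ⟨fun x => if x = a then r - s else if x = b then r - P - (s - Q) else p x,
      fun x => if x = a then r + s else if x = b then r - P + (s - Q) else q x, fun x => ?_, ?_, ?_,
      fun x hxa hxb => ?_⟩
    · have hr' : (p a : ℂ) = r + r - P := by exact_mod_cast eq_sub_of_add_eq hr
      have hs' : (q a : ℂ) = s + s - Q := by exact_mod_cast eq_sub_of_add_eq hs
      rw [hr', hs'] at hwa
      rw [twoLevel_mulVec]
      by_cases hxa : x = a
      · subst hxa
        simp [matK]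
        linear_combination ((1 + Complex.I) / 2) * (hwa + hwb) + (s : ℂ) * hI
      · by_cases hxb : x = b
        · subst hxb
          simp [matK, hxa]
          linear_combination ((1 + Complex.I) / 2) * (hwa - hwb) + ((s : ℂ) - Q) * hI
        · simp [hxa, hxb, hw x hxa hxb]
    · simp only [if_true]
      exact ⟨r, by ring⟩
    · simp only [if_neg hab.symm, if_true]
      exact ⟨r - P, by ring⟩
    · simp [hxa, hxb]
  -- An odd coordinate is `1` or `i` mod 2. If the two classes differ, a phase at `b` replaces `p +
  -- q i` by `-q + p i` and makes them equal.
  by_cases hpar : Even (p a + p b)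
  · obtain ⟨p', q', h⟩ := key v (p b) (q b) (hv a) (hv b) (fun x _ _ => hv x) hpar (by grind)
    exact ⟨_, hK, p', q', h⟩
  · obtain ⟨p', q', h⟩ := key (phaseGate b *ᵥ v) (-q b) (p b)
      (by rw [phaseGate_mulVec_apply, if_neg hab, hv])
      (by
        rw [phaseGate_mulVec_apply, if_pos rfl]
        push_cast
        linear_combination Complex.I * hv b + (q b : ℂ) * hI)
      (fun x _ hxb => by rw [phaseGate_mulVec_apply, if_neg hxb, hv]) (by grind) (by grind)
    refine ⟨_, mul_mem hK (phaseGate_mem_representableFixing hb), p', q', ?_⟩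
    rw [← Matrix.mulVec_mulVec]
    exact h

theorem mem_representableFixing_unitary {n : ℕ} {T : Finset (Bits n)} {g : QMatrix n}
    (hg : g ∈ representableFixing T) : g ∈ Matrix.unitaryGroup (Bits n) ℂ :=
  (mem_unitaryOver_of_representableWithAncillas hg.1).1

/-- Scaling by `1 + i` doubles the squared norm. -/
theorem sum_sq_eq {ι : Type*} [Fintype ι] {k : ℕ} {v : ι → ℂ} {p q : ι → ℤ}
    (hv : ∀ x, (1 + Complex.I) ^ k * v x = p x + q x * Complex.I)
    (hn : ∑ x, Complex.normSq (v x) = 1) : ∑ x, (p x ^ 2 + q x ^ 2) = 2 ^ k := by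
  have h1 : Complex.normSq (1 + Complex.I) = 2 := by
    norm_num [Complex.normSq_apply]
  have h : ∀ x, ((p x ^ 2 + q x ^ 2 : ℤ) : ℝ) = 2 ^ k * Complex.normSq (v x) := fun x => by
    rw [← h1, ← map_pow, ← map_mul, hv, Complex.normSq_apply]
    simp
    ring
  have : ((∑ x, (p x ^ 2 + q x ^ 2) : ℤ) : ℝ) = 2 ^ k := by
    rw [Int.cast_sum, Finset.sum_congr rfl fun x _ => h x, ← Finset.mul_sum, hn, mul_one]
  exact_mod_cast this

theorem even_sq_add_sq (p q : ℤ) : Even (p ^ 2 + q ^ 2) ↔ Even (p + q) := by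
  simp [Int.even_add, Int.even_pow]

/-- All coordinates can be made even. -/
theorem exists_even_reduction {n : ℕ} {T : Finset (Bits n)} {k : ℕ} (m : ℕ) :
    ∀ {v : Bits n → ℂ} {p q : Bits n → ℤ},
      (∀ x, (1 + Complex.I) ^ (k + 1) * v x = p x + q x * Complex.I) → (∀ x, x ∉ T → v x = 0) →
      ∑ x, Complex.normSq (v x) = 1 →
      (Finset.univ.filter fun x => Odd (p x + q x)).card ≤ m →
      ∃ g ∈ representableFixing T, ∃ p' q' : Bits n → ℤ,
        (∀ x, (1 + Complex.I) ^ (k + 1) * (g *ᵥ v) x = p' x + q' x * Complex.I) ∧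
        ∀ x, Even (p' x + q' x) := by
  induction m with
  | zero =>
    intro v p q hv _ _ hm
    refine ⟨1, one_mem _, p, q, by simpa using hv, fun x => ?_⟩
    rw [Nat.le_zero, Finset.card_eq_zero, Finset.filter_eq_empty_iff] at hm
    exact Int.not_odd_iff_even.1 (hm (Finset.mem_univ x))
  | succ m ih =>
    intro v p q hv hT hn hm
    by_cases hodd : ∃ a, Odd (p a + q a)
    · obtain ⟨a, ha⟩ := hodd
      -- The norms sum to `2 ^ (k + 1)`, which is even, and a norm has the parity of `p + q`; so a
      -- single odd coordinate is impossible.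
      obtain ⟨b, hba, hb⟩ : ∃ b, b ≠ a ∧ Odd (p b + q b) := by
        by_contra! hcon
        have hs := sum_sq_eq hv hn
        rw [← Finset.add_sum_erase _ _ (Finset.mem_univ a)] at hs
        have h2 : Even (∑ x ∈ Finset.univ.erase a, (p x ^ 2 + q x ^ 2)) := by
          refine Finset.even_sum _ fun x hx => ?_
          exact (even_sq_add_sq _ _).2
            (Int.not_odd_iff_even.1 (hcon x (Finset.ne_of_mem_erase hx)))
        have h3 : Odd (p a ^ 2 + q a ^ 2) := by
          rwa [← Int.not_even_iff_odd, even_sq_add_sq, Int.not_even_iff_odd]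
        have h4 : Even ((2 : ℤ) ^ (k + 1)) := by simp [pow_succ]
        rw [← hs] at h4
        exact (Int.not_even_iff_odd.2 (h3.add_even h2)) h4
      -- Coordinates outside `T` vanish, so the gates used never touch them.
      have hmem : ∀ x, Odd (p x + q x) → x ∈ T := by
        intro x hx
        by_contra hxT
        have h := hv x
        rw [hT x hxT, mul_zero] at h
        have hre := congrArg Complex.re h
        have him := congrArg Complex.im h
        simp at hre him
        have hp : p x = 0 := by exact_mod_cast hre.symm
        have hq : q x = 0 := by exact_mod_cast him.symm
        simp [hp, hq] at hx
      obtain ⟨g, hg, p', q', hv', hea, heb, hrest⟩ :=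
        exists_pair_reduction hv (hmem a ha) (hmem b hb) hba.symm ha hb
      have hu := mem_representableFixing_unitary hg
      obtain ⟨g', hg', p'', q'', h⟩ := ih hv'
        (fun x hx => by rw [mulVec_apply_of_fixes hu (hg.2 x hx), hT x hx])
        ((sum_normSq_mulVec hu v).trans hn) (by
          rw [← Nat.lt_succ_iff]
          refine lt_of_lt_of_le (Finset.card_lt_card ?_) hm
          refine Finset.ssubset_iff_subset_ne.2 ⟨fun x hx => ?_, fun h => ?_⟩
          · simp only [Finset.mem_filter, Finset.mem_univ, true_and] at hx ⊢
            by_cases hxa : x = a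
            · rwa [hxa]
            · by_cases hxb : x = b
              · rwa [hxb]
              · rwa [← (hrest x hxa hxb).1, ← (hrest x hxa hxb).2]
          · have h' := (Finset.ext_iff.1 h a).2 (by simpa using ha)
            simp only [Finset.mem_filter, Finset.mem_univ, true_and] at h'
            exact Int.not_even_iff_odd.2 h' hea)
      refine ⟨g' * g, mul_mem hg' hg, p'', q'', ?_⟩
      rwa [← Matrix.mulVec_mulVec]
    · refine ⟨1, one_mem _, p, q, by simpa using hv, fun x => ?_⟩
      exact Int.not_odd_iff_even.1 fun h => hodd ⟨x, h⟩

/-- Gaussian integers whose norms sum to 1 are all zero except for one unit, a power of `i`. Phases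
turn it into 1 and a swap moves it to `j`. -/
theorem exists_basis_reduction {n : ℕ} {T : Finset (Bits n)} {j : Bits n} (hj : j ∈ T)
    {v : Bits n → ℂ} {p q : Bits n → ℤ} (hv : ∀ x, v x = p x + q x * Complex.I)
    (hT : ∀ x, x ∉ T → v x = 0) (hn : ∑ x, Complex.normSq (v x) = 1) :
    ∃ g ∈ representableFixing T, g *ᵥ v = Pi.single j 1 := by
  have hs : ∑ x, (p x ^ 2 + q x ^ 2) = 1 := by
    simpa using sum_sq_eq (k := 0) (by simpa using hv) hn
  have hpos : ∀ x, 0 ≤ p x ^ 2 + q x ^ 2 := fun x => by positivity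
  obtain ⟨a, ha⟩ : ∃ a, p a ^ 2 + q a ^ 2 ≠ 0 := by
    by_contra! hcon
    simp [hcon] at hs
  rw [← Finset.add_sum_erase _ _ (Finset.mem_univ a)] at hs
  have hrest : 0 ≤ ∑ x ∈ Finset.univ.erase a, (p x ^ 2 + q x ^ 2) :=
    Finset.sum_nonneg fun x _ => hpos x
  have ha1 : p a ^ 2 + q a ^ 2 = 1 := by have := hpos a; omega
  have hzero : ∀ x, x ≠ a → v x = 0 := by
    intro x hx
    have h := (Finset.sum_eq_zero_iff_of_nonneg (s := Finset.univ.erase a) fun x _ => hpos x).1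
      (by omega) x (by simp [hx])
    have hp : p x = 0 := by nlinarith [sq_nonneg (p x), sq_nonneg (q x)]
    have hq : q x = 0 := by nlinarith [sq_nonneg (p x), sq_nonneg (q x)]
    rw [hv, hp, hq]
    simp
  have hva : v = Pi.single a (v a) := by
    ext x
    by_cases hx : x = a
    · subst hx; simp
    · simp [hx, hzero x hx]
  obtain ⟨e, he⟩ : ∃ e : ℕ, Complex.I ^ e * v a = 1 := by
    have hp1 : -1 ≤ p a := by nlinarith [sq_nonneg (q a)]
    have hp2 : p a ≤ 1 := by nlinarith [sq_nonneg (q a)]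
    have hq1 : -1 ≤ q a := by nlinarith [sq_nonneg (p a)]
    have hq2 : q a ≤ 1 := by nlinarith [sq_nonneg (p a)]
    rw [hv]
    generalize p a = P at *
    generalize q a = Q at *
    interval_cases P <;> interval_cases Q <;> simp at ha1
    · exact ⟨2, by simp⟩
    · exact ⟨1, by simp⟩
    · exact ⟨3, by simp [pow_succ]⟩
    · exact ⟨0, by simp⟩
  have haT : a ∈ T := by
    by_contra h
    simp [hT a h] at he
  have hphase : ∀ (e : ℕ) (u : ℂ),
      phaseGate a ^ e *ᵥ (Pi.single a u : Bits n → ℂ) = Pi.single a (Complex.I ^ e * u) := by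
    intro e u
    induction e with
    | zero => rw [pow_zero, pow_zero, Matrix.one_mulVec, one_mul]
    | succ e ih =>
      rw [pow_succ', ← Matrix.mulVec_mulVec, ih]
      ext x
      rw [phaseGate_mulVec_apply]
      by_cases hx : x = a
      · subst hx; simp [pow_succ']; ring
      · simp [hx]
  have hg := pow_mem (phaseGate_mem_representableFixing haT) e
  have hgv : phaseGate a ^ e *ᵥ v = Pi.single a 1 := by rw [hva, hphase, he]
  by_cases haj : a = j
  · exact ⟨_, hg, by rw [hgv, haj]⟩
  · have hX : twoLevel a j matX ∈ representableFixing T :=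
      ⟨(twoLevel_mem haj).1, fun x hx => twoLevel_fixes haT hj hx _⟩
    refine ⟨_, mul_mem hX hg, ?_⟩
    rw [← Matrix.mulVec_mulVec, hgv, twoLevel_mulVec]
    ext x
    by_cases hxa : x = a
    · subst hxa; simp [matX, haj, Ne.symm haj]
    · by_cases hxj : x = j
      · subst hxj; simp [matX, hxa]
      · simp [hxa, hxj]

theorem exists_column_reduction {n : ℕ} {T : Finset (Bits n)} {j : Bits n} (hj : j ∈ T) (k : ℕ) :
    ∀ {v : Bits n → ℂ}, (∀ x, IsGaussianInteger ((1 + Complex.I) ^ k * v x)) →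
      (∀ x, x ∉ T → v x = 0) → ∑ x, Complex.normSq (v x) = 1 →
      ∃ g ∈ representableFixing T, g *ᵥ v = Pi.single j 1 := by
  induction k with
  | zero =>
    intro v hv hT hn
    choose p q hv using hv
    exact exists_basis_reduction hj (by simpa using hv) hT hn
  | succ k ih =>
    intro v hv hT hn
    choose p q hv using hv
    obtain ⟨g, hg, p', q', hv', heven⟩ := exists_even_reduction _ hv hT hn le_rfl
    have hu := mem_representableFixing_unitary hg
    have hI := Complex.I_mul_I
    obtain ⟨g', hg', h⟩ := ih (v := g *ᵥ v)
      (fun x => by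
        obtain ⟨r, hr⟩ := heven x
        have hr' : (p' x : ℂ) = r + r - q' x := by exact_mod_cast eq_sub_of_add_eq hr
        -- The quotient by `1 + i`: when `p' + q' = 2 r`, one has `p' + q' i = (1 + i)(r + (q' - r)
        -- i)`.
        refine ⟨r, q' x - r, ?_⟩
        have h0 : (1 + Complex.I) ≠ 0 := fun h => by simpa using congrArg Complex.re h
        apply mul_left_cancel₀ h0
        rw [← mul_assoc, ← pow_succ', hv', hr']
        push_cast
        linear_combination ((r : ℂ) - q' x) * hI)
      (fun x hx => by rw [mulVec_apply_of_fixes hu (hg.2 x hx), hT x hx])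
      ((sum_normSq_mulVec hu v).trans hn)
    refine ⟨g' * g, mul_mem hg' hg, ?_⟩
    rwa [← Matrix.mulVec_mulVec]

/-- Induction on the set `T` of columns not yet known to be trivial. Reducing column `j` by some `g`
that fixes the basis vectors outside `insert j T` keeps the finished columns, so the hypothesis
applies to `g V`, and `V = gᴴ (g V)`. -/
theorem mem_representableOne_of_fixes {n : ℕ} (T : Finset (Bits n)) :
    ∀ {V : QMatrix n}, V ∈ unitaryOver n gaussianDyadic →
      (∀ x, x ∉ T → V *ᵥ Pi.single x 1 = Pi.single x 1) → V ∈ representableOne n := by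
  induction T using Finset.induction_on with
  | empty =>
    intro V _ h
    have : V = 1 := Matrix.ext_of_mulVec_single fun x => by
      rw [h x (by simp), Matrix.one_mulVec]
    rw [this]
    exact one_mem _
  | insert j T _ ih =>
    intro V hV h
    have hcol : ∀ x, (V *ᵥ Pi.single j 1) x = V x j := fun x => by simp
    obtain ⟨k, hk⟩ := exists_common_pow_mul_isGaussianInteger
      (v := V *ᵥ Pi.single j 1) fun x => by rw [hcol]; exact hV.2 x j
    obtain ⟨g, hg, hgv⟩ := exists_column_reduction (Finset.mem_insert_self j T) k hk
      -- Unitarity forces column `j` to vanish at every basis vector that `V` already fixes.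
      (fun x hx => by
        rw [mulVec_apply_of_fixes hV.1 (h x hx)]
        exact Pi.single_eq_of_ne (ne_of_mem_of_not_mem (Finset.mem_insert_self j T) hx).symm _)
      (by
        rw [sum_normSq_mulVec hV.1, Finset.sum_eq_single j]
        · simp
        · intro x _ hx; simp [hx]
        · simp)
    have hgu := mem_unitaryOver_of_representableWithAncillas hg.1
    have hgV : g * V ∈ representableOne n := by
      refine ih (unitaryOver_mul_mem hgu hV) fun x hx => ?_
      rw [← Matrix.mulVec_mulVec]
      by_cases hxj : x = j
      · rw [hxj, hgv]
      · have hx' : x ∉ insert j T := by simp [hxj, hx]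
        rw [h x hx', hg.2 x hx']
    have hgg : gᴴ * g = 1 := Matrix.mem_unitaryGroup_iff'.1 hgu.1
    have hVeq : V = gᴴ * (g * V) := by rw [← Matrix.mul_assoc, hgg, Matrix.one_mul]
    rw [hVeq]
    exact mul_mem (conjTranspose_mem_representableOne hg.1) hgV

end

theorem mainTheorem4 (n : ℕ) (V : QMatrix n) :
    (Representable gaussianGates V ↔ V ∈ unitaryOver n gaussianDyadic) ∧
      (V ∈ unitaryOver n gaussianDyadic → RepresentableWithAncillas gaussianGates 1 V) := by
  have h : V ∈ unitaryOver n gaussianDyadic → RepresentableWithAncillas gaussianGates 1 V :=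
    fun hV => mem_representableOne_of_fixes Finset.univ hV (by simp)
  exact ⟨⟨fun ⟨_, hm⟩ => mem_unitaryOver_of_representableWithAncillas hm, fun hV => ⟨1, h hV⟩⟩, h⟩
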